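/- Let $X$ be a random variable with values in $\mathbb{R}^d$ with $\mathbb{E}\|X\|^2<\infty$, and let $Y$ be a random variable (the guidance signal) with values in a measurable space $\mathcal Y$, with law $P_Y$. Assume that for $P_Y$-almost every $y$ the conditional law of $X$ given $Y=y$ has a density $q(\cdot\mid y)$, so that $X$ has a density $q$ as well. Consider the linear conditional flow $\psi_t(x\mid x_1)=t x_1+(1-t)x$ with standard Gaussian prior $X_0\sim\mathcal N(0,I)$, its conditional path $p_{t\mid 1}(\cdot\mid x_1)=\mathcal N(\cdot\mid t x_1,(1-t)^2 I)$ and its conditional velocity field $u_t(x\mid x_1)=\frac{x_1-x}{1-t}$, $0\le t<1$. Define the guided and the unconditional marginal probability paths $$p_{t\mid Y}(x\mid y)=\int p_{t\mid 1}(x\mid x_1)\,q(x_1\mid y)\,dx_1,\qquad p_t(x)=\int p_{t\mid 1}(x\mid x_1)\,q(x_1)\,dx_1,$$ with $p_{1\mid Y}=q(\cdot\mid y)$ and $p_1=q$, and the guided and the unconditional marginal velocity fields $$u_t(x\mid y)=\int u_t(x\mid x_1)\frac{p_{t\mid 1}(x\mid x_1)q(x_1\mid y)}{p_{t\mid Y}(x\mid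 y)}\,dx_1,\qquad u_t(x)=\int u_t(x\mid x_1)\frac{p_{t\mid 1}(x\mid x_1)q(x_1)}{p_t(x)}\,dx_1 .$$ For $0<t<1$ put $$g(y,t)=\mathbb{E}_{X_t\sim p_{t\mid Y}(\cdot\mid y)}\Big[\tfrac{t}{1-t}\,u_t(X_t\mid y)\cdot\big(u_t(X_t\mid y)-u_t(X_t)\big)\Big],$$ and assume that $g$ is integrable on $\mathcal Y\times(0,1)$ with respect to $P_Y\otimes dt$. Then the mutual information $I(X;Y)=D_{\mathrm{KL}}(P_{(X,Y)}\,\|\,P_X\otimes P_Y)$ is finite, and $$I(X;Y)=\mathbb{E}_Y\big[D_{\mathrm{KL}}(P_{X\mid Y}\,\|\,P_X)\big]=\mathbb{E}_Y\Big[\int p_{1\mid Y}(x_1\mid Y)\log\frac{p_{1\mid Y}(x_1\mid Y)}{p_1(x_1)}\,dx_1\Big]$$ $$=\mathbb{E}_Y\Big[\int_0^1\mathbb{E}_{X_t\mid Y}\Big[\tfrac{t}{1-t}\,u_t(X_t\mid Y)\cdot\big(u_t(X_t\mid Y)-u_t(X_t)\big)\Big]dt\Big].$$ -/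

import Mathlib

open MeasureTheory ProbabilityTheory InformationTheory
open scoped ENNReal

namespace FlowMI

noncomputable section

/-- Mutual information `I(X;Y)`: the Kullback–Leibler divergence of the joint law from the product
of the marginal laws. -/
def mutualInfo {Ω S T : Type*} [MeasurableSpace Ω] [MeasurableSpace S] [MeasurableSpace T]
    (P : Measure Ω) (X : Ω → S) (Y : Ω → T) : ℝ≥0∞ :=
  klDiv (P.map fun ω => (X ω, Y ω)) ((P.map X).prod (P.map Y))

variable {d : ℕ}

/-- Lebesgue density of a measure on `ℝᵈ`. -/
def density (ν : Measure (EuclideanSpace ℝ (Fin d))) (x : EuclideanSpace ℝ (Fin d)) : ℝ :=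
  (ν.rnDeriv volume x).toReal

/-- The linear conditional flow `ψ_t(x ∣ x₁) = t x₁ + (1 - t) x`. -/
def linearFlow (t : ℝ) (x₁ x : EuclideanSpace ℝ (Fin d)) : EuclideanSpace ℝ (Fin d) :=
  t • x₁ + (1 - t) • x

/-- The probability path with target law `ν`: the law of `X_t = ψ_t(X₀ ∣ X₁)`, with `X₁ ∼ ν` and
`X₀ ∼ N(0, I)` independent. -/
def probPath (ν : Measure (EuclideanSpace ℝ (Fin d))) (t : ℝ) :
    Measure (EuclideanSpace ℝ (Fin d)) :=
  (ν.prod (stdGaussian (EuclideanSpace ℝ (Fin d)))).map fun z => linearFlow t z.1 z.2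

/-- The density `p_{t∣1}(x ∣ x₁)` of `N(t x₁, (1 - t)² I)`, the law of `ψ_t(X₀ ∣ x₁)`, for
`t < 1`. -/
def condPathDensity (t : ℝ) (x₁ x : EuclideanSpace ℝ (Fin d)) : ℝ :=
  ((√(2 * Real.pi) * (1 - t)) ^ d)⁻¹ * Real.exp (-‖x - t • x₁‖ ^ 2 / (2 * (1 - t) ^ 2))

/-- The velocity field `u_t(x ∣ x₁)` of the linear conditional flow, for `t < 1`. -/
def condVelocity (t : ℝ) (x₁ x : EuclideanSpace ℝ (Fin d)) : EuclideanSpace ℝ (Fin d) :=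
  (1 - t)⁻¹ • (x₁ - x)

/-- `d/dt ψ_t(x ∣ x₁) = u_t(ψ_t(x ∣ x₁) ∣ x₁)`. -/
theorem hasDerivAt_linearFlow (t : ℝ) (ht : t < 1) (x₁ x : EuclideanSpace ℝ (Fin d)) :
    HasDerivAt (fun s => linearFlow s x₁ x) (condVelocity t x₁ (linearFlow t x₁ x)) t := by
  have h : condVelocity t x₁ (linearFlow t x₁ x) = (1 : ℝ) • x₁ + (-1 : ℝ) • x := by
    have h1 : x₁ - linearFlow t x₁ x = (1 - t) • (x₁ - x) := by
      unfold linearFlow; module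
    rw [condVelocity, h1, smul_smul, inv_mul_cancel₀ (by linarith)]
    module
  rw [h]
  exact ((hasDerivAt_id t).smul_const x₁).add (((hasDerivAt_id t).const_sub 1).smul_const x)

/-- The marginal density `p_t(x) = ∫ p_{t∣1}(x ∣ x₁) ν(dx₁)`. -/
def pathDensity (ν : Measure (EuclideanSpace ℝ (Fin d))) (t : ℝ)
    (x : EuclideanSpace ℝ (Fin d)) : ℝ :=
  ∫ x₁, condPathDensity t x₁ x ∂ν

/-- The marginal velocity field `u_t(x) = ∫ u_t(x ∣ x₁) p_{1∣t}(x₁ ∣ x) dx₁`, where the posterior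
law `p_{1∣t}(· ∣ x)` has density `p_{t∣1}(x ∣ ·) / p_t(x)` with respect to the target law `ν`. -/
def velocity (ν : Measure (EuclideanSpace ℝ (Fin d))) (t : ℝ)
    (x : EuclideanSpace ℝ (Fin d)) : EuclideanSpace ℝ (Fin d) :=
  ∫ x₁, (condPathDensity t x₁ x / pathDensity ν t x) • condVelocity t x₁ x ∂ν

/-- `E_{X_t ∼ p_t^A} [t / (1 - t) * u_t^A(X_t) · (u_t^A(X_t) - u_t^B(X_t))]` for the probability
paths with target laws `A` and `B`. -/
def velocityGap (A B : Measure (EuclideanSpace ℝ (Fin d))) (t : ℝ) : ℝ :=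
  ∫ x, t / (1 - t) * inner ℝ (velocity A t x) (velocity A t x - velocity B t x) ∂(probPath A t)

end

end FlowMI

/-!
For two target laws `A` and `B`, the divergence `D_t = KL(p_t^A ‖ p_t^B)` vanishes at `t = 0`, where
both paths are standard Gaussian, and increases to `KL(A ‖ B)` as `t → 1`: data processing bounds
`D_t` by `KL(A ‖ B)`, and lower semicontinuity of the divergence under weak convergence gives the
reverse inequality in the limit. Up to scaling, `p_t^A` is the law of `a X + N` with `X ∼ A`,
standard Gaussian noise `N` and signal strength `a = t / (1 - t)`. The velocity `u_t^A` is an affine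
function of the posterior mean of `X` given `a X + N`, and Gaussian integration by parts yields the
relative form of the I-MMSE identity, `dD_t/dt = t / (1 - t) * E‖u_t^A(X_t) - u_t^B(X_t)‖²`. Hence
`KL(A ‖ B)` is the integral over `(0, 1)` of the squared velocity gap, without any finiteness
assumption.

Take `A` to be the law of `X` given `Y = y` and `B` the law of `X`. The integrand of the theorem
exceeds the squared gap by `t / (1 - t) * E⟪u_t^A - u_t^B, u_t^B⟫`, and by the tower property this
cross term does not change when `u_t^A` is replaced by the conditional velocity, after which it is
linear in `A`. Averaging over `y` turns `A` into `B`, so the cross term averages to zero. The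
averaged divergence of the conditional laws from the law of `X` is the mutual information.
-/

namespace FlowMI

open Filter Topology
open scoped BoundedContinuousFunction RealInnerProductSpace

noncomputable section

section KullbackLeibler

variable {S : Type*} [MeasurableSpace S] {μ ν : Measure S}

/-- The objective of the variational (Donsker–Varadhan) formula for the Kullback–Leibler
divergence, normalised for finite measures of arbitrary mass: `klDiv μ ν` is its supremum over
bounded test functions. -/
def klDual (μ ν : Measure S) (f : S → ℝ) : ℝ := ∫ x, f x ∂μ - ∫ x, (Real.exp (f x) - 1) ∂ν

theorem mul_le_klFun_add_exp_sub_one {r : ℝ} (hr : 0 ≤ r) (g : ℝ) :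
    r * g ≤ klFun r + (Real.exp g - 1) := by
  rw [klFun_apply]
  rcases hr.eq_or_lt with rfl | hr
  · simpa using (Real.exp_pos g).le
  · have h := Real.add_one_le_exp (g - Real.log r)
    rw [Real.exp_sub, Real.exp_log hr, le_div_iff₀ hr] at h
    linarith

variable [IsFiniteMeasure μ]

theorem absolutelyContinuous_of_klDual_le {L : ℝ}
    (h : ∀ (f : S → ℝ) (c : ℝ), Measurable f → (∀ x, |f x| ≤ c) → klDual μ ν f ≤ L) :
    μ ≪ ν := by
  refine Measure.AbsolutelyContinuous.mk fun s hs hνs => ?_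
  have hmul_le (n : ℕ) : n * μ.real s ≤ L := by
    have hexp : ∫ x, (Real.exp (s.indicator (fun _ => (n : ℝ)) x) - 1) ∂ν = 0 := by
      refine integral_eq_zero_of_ae ?_
      filter_upwards [measure_eq_zero_iff_ae_notMem.1 hνs] with x hx
      simp [hx]
    have := h (s.indicator fun _ => (n : ℝ)) n (measurable_const.indicator hs) fun x => by
      by_cases hx : x ∈ s <;> simp [hx]
    rwa [klDual, hexp, sub_zero, integral_indicator hs, setIntegral_const, smul_eq_mul,
      mul_comm] at this
  by_contra hne
  obtain ⟨n, hn⟩ := exists_nat_gt (L / μ.real s)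
  have hpos : 0 < μ.real s := ENNReal.toReal_pos hne (measure_ne_top _ _)
  rw [div_lt_iff₀ hpos] at hn
  exact (hmul_le n).not_gt hn

variable [IsFiniteMeasure ν]

theorem ofReal_klDual_le_klDiv {g : S → ℝ} (hg : Integrable g μ)
    (hexp : Integrable (fun x => Real.exp (g x)) ν) :
    ENNReal.ofReal (klDual μ ν g) ≤ klDiv μ ν := by
  by_cases htop : klDiv μ ν = ⊤
  · simp [htop]
  obtain ⟨hac, hllr⟩ := klDiv_ne_top_iff.1 htop
  refine ENNReal.ofReal_le_of_le_toReal ?_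
  have hkl := (integrable_klFun_rnDeriv_iff hac).2 hllr
  have hexp' := hexp.sub' (integrable_const 1)
  rw [toReal_klDiv_eq_integral_klFun hac, klDual, ← integral_rnDeriv_smul hac,
    sub_le_iff_le_add, ← integral_add hkl hexp']
  exact integral_mono ((integrable_rnDeriv_smul_iff hac).2 hg) (hkl.add hexp') fun x =>
    mul_le_klFun_add_exp_sub_one ENNReal.toReal_nonneg (g x)

theorem exp_sub_exp_le {u v c : ℝ} (hv : v ≤ c) :
    Real.exp v - Real.exp u ≤ Real.exp c * |u - v| := by
  have h1 := Real.add_one_le_exp (u - v)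
  rw [Real.exp_sub, le_div_iff₀ (Real.exp_pos v)] at h1
  calc Real.exp v - Real.exp u ≤ Real.exp v * -(u - v) := by linarith
    _ ≤ Real.exp v * |u - v| := by gcongr; exact neg_le_abs _
    _ ≤ Real.exp c * |u - v| := by gcongr

theorem integrable_exp_of_abs_le {f : S → ℝ} (hf : Measurable f) {c : ℝ}
    (hc : ∀ x, |f x| ≤ c) : Integrable (fun x => Real.exp (f x)) ν :=
  .of_bound (by fun_prop) (Real.exp c) <| ae_of_all _ fun x => by
    rw [Real.norm_eq_abs, Real.abs_exp]
    exact Real.exp_le_exp.2 ((le_abs_self _).trans (hc x))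

theorem klDual_le_klDual_add {f g : S → ℝ} (hf : Measurable f) (hg : Measurable g) {c : ℝ}
    (hfc : ∀ x, |f x| ≤ c) (hgc : ∀ x, |g x| ≤ c) :
    klDual μ ν f ≤ klDual μ ν g + (∫ x, |f x - g x| ∂μ + Real.exp c * ∫ x, |f x - g x| ∂ν) := by
  have int_of_abs_le (ρ : Measure S) [IsFiniteMeasure ρ] {h : S → ℝ} (hh : Measurable h)
      (hhc : ∀ x, |h x| ≤ c) : Integrable h ρ :=
    .of_bound hh.aestronglyMeasurable c (ae_of_all _ hhc)
  have int_abs_sub (ρ : Measure S) [IsFiniteMeasure ρ] : Integrable (fun x => |f x - g x|) ρ :=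
    ((int_of_abs_le ρ hf hfc).sub (int_of_abs_le ρ hg hgc)).abs
  have hμ : ∫ x, f x ∂μ ≤ ∫ x, g x ∂μ + ∫ x, |f x - g x| ∂μ := by
    rw [← integral_add (int_of_abs_le μ hg hgc) (int_abs_sub μ)]
    refine integral_mono (int_of_abs_le μ hf hfc)
      ((int_of_abs_le μ hg hgc).add (int_abs_sub μ)) fun x => ?_
    simpa only [Pi.add_apply, ← sub_le_iff_le_add'] using le_abs_self (f x - g x)
  have hν : ∫ x, (Real.exp (g x) - 1) ∂ν ≤
      ∫ x, (Real.exp (f x) - 1) ∂ν + Real.exp c * ∫ x, |f x - g x| ∂ν := by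
    have hf' := (integrable_exp_of_abs_le (ν := ν) hf hfc).sub' (integrable_const 1)
    have hd' := (int_abs_sub ν).const_mul (Real.exp c)
    rw [← integral_const_mul, ← integral_add hf' hd']
    refine integral_mono ((integrable_exp_of_abs_le hg hgc).sub' (integrable_const 1))
      (hf'.add hd') fun x => ?_
    have := exp_sub_exp_le (u := f x) ((le_abs_self _).trans (hgc x))
    linarith
  simp only [klDual]
  linarith

/-- The truncation of `r` to the interval `[1 / (n + 1), n + 1]`, used to approximate `log r` by
bounded functions. -/
def clampPos (n : ℕ) (r : ℝ) : ℝ := max ((n + 1 : ℝ)⁻¹) (min r (n + 1))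

@[fun_prop]
theorem measurable_clampPos (n : ℕ) : Measurable (clampPos n) := by unfold clampPos; fun_prop

@[fun_prop]
theorem measurable_log_clampPos (n : ℕ) : Measurable fun r => Real.log (clampPos n r) :=
  Real.measurable_log.comp (measurable_clampPos n)

theorem clampPos_pos (n : ℕ) (r : ℝ) : 0 < clampPos n r := lt_max_of_lt_left (by positivity)

theorem inv_natCast_add_one_le_one (n : ℕ) : (n + 1 : ℝ)⁻¹ ≤ 1 :=
  inv_le_one_of_one_le₀ (by simp)

theorem clampPos_le (n : ℕ) (r : ℝ) : clampPos n r ≤ n + 1 :=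
  max_le ((inv_natCast_add_one_le_one n).trans (by simp)) (min_le_right _ _)

theorem abs_log_clampPos_le (n : ℕ) (r : ℝ) : |Real.log (clampPos n r)| ≤ Real.log (n + 1) :=
  abs_le.2 ⟨by
    rw [← Real.log_inv]
    exact Real.log_le_log (by positivity) (le_max_left _ _),
    Real.log_le_log (clampPos_pos n r) (clampPos_le n r)⟩

theorem sub_clampPos_mul_log_clampPos_nonneg (n : ℕ) (r : ℝ) :
    0 ≤ (r - clampPos n r) * Real.log (clampPos n r) := by
  have hn : (1 : ℝ) ≤ n + 1 := by simp
  rcases le_total r 1 with hr | hr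
  · exact mul_nonneg_of_nonpos_of_nonpos
      (sub_nonpos.2 (le_max_of_le_right (le_min le_rfl (hr.trans hn))))
      (Real.log_nonpos (clampPos_pos n r).le
        (max_le (inv_natCast_add_one_le_one n) ((min_le_left _ _).trans hr)))
  · exact mul_nonneg
      (sub_nonneg.2 (max_le ((inv_natCast_add_one_le_one n).trans hr) (min_le_left _ _)))
      (Real.log_nonneg (le_max_of_le_right (le_min hr hn)))

theorem tendsto_clampPos {r : ℝ} (hr : 0 ≤ r) :
    Tendsto (fun n => clampPos n r) atTop (𝓝 r) := by
  have hinv : Tendsto (fun n : ℕ => ((n : ℝ) + 1)⁻¹) atTop (𝓝 0) := by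
    simpa only [one_div] using tendsto_one_div_add_atTop_nhds_zero_nat (𝕜 := ℝ)
  have hmin : Tendsto (fun n : ℕ => min r (n + 1)) atTop (𝓝 r) := by
    obtain ⟨N, hN⟩ := exists_nat_ge r
    refine tendsto_const_nhds.congr' ?_
    filter_upwards [eventually_ge_atTop N] with n hn
    exact (min_eq_left (hN.trans (by exact_mod_cast hn.trans n.le_succ))).symm
  simpa only [clampPos, max_eq_right hr] using hinv.max hmin

theorem tendsto_mul_log_clampPos {r : ℝ} (hr : 0 ≤ r) :
    Tendsto (fun n => r * Real.log (clampPos n r) - (clampPos n r - 1)) atTop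
      (𝓝 (klFun r)) := by
  have hlog : Tendsto (fun n => r * Real.log (clampPos n r)) atTop (𝓝 (r * Real.log r)) := by
    rcases hr.eq_or_lt with rfl | h0
    · simp
    · exact ((tendsto_clampPos hr).log h0.ne').const_mul r
  have hklFun : klFun r = r * Real.log r - (r - 1) := by rw [klFun_apply]; ring
  exact hklFun ▸ hlog.sub ((tendsto_clampPos hr).sub_const 1)

theorem mul_log_clampPos_sub_nonneg (n : ℕ) (r : ℝ) :
    0 ≤ r * Real.log (clampPos n r) - (clampPos n r - 1) := by
  have h1 := klFun_nonneg (clampPos_pos n r).le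
  have h2 := sub_clampPos_mul_log_clampPos_nonneg n r
  rw [klFun_apply] at h1
  linarith

theorem ofReal_klDual_log_clampPos (hac : μ ≪ ν) (n : ℕ) :
    ENNReal.ofReal (klDual μ ν fun x => Real.log (clampPos n (μ.rnDeriv ν x).toReal)) =
      ∫⁻ x, ENNReal.ofReal ((μ.rnDeriv ν x).toReal *
        Real.log (clampPos n (μ.rnDeriv ν x).toReal) -
          (clampPos n (μ.rnDeriv ν x).toReal - 1)) ∂ν := by
  set r : S → ℝ := fun x => (μ.rnDeriv ν x).toReal with hr
  have hrm : Measurable r := by fun_prop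
  have hlog : Integrable (fun x => r x * Real.log (clampPos n (r x))) ν :=
    (integrable_rnDeriv_smul_iff hac).2 <|
      .of_bound ((measurable_log_clampPos n).comp hrm).aestronglyMeasurable (Real.log (n + 1)) <|
        ae_of_all _ fun x => abs_log_clampPos_le n _
  have hclamp : Integrable (fun x => clampPos n (r x)) ν :=
    .of_bound ((measurable_clampPos n).comp hrm).aestronglyMeasurable (n + 1 : ℝ) <|
      ae_of_all _ fun x => by
        rw [Real.norm_of_nonneg (clampPos_pos n _).le]
        exact clampPos_le n _
  rw [← ofReal_integral_eq_lintegral_ofReal (hlog.sub' (hclamp.sub' (integrable_const 1)))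
      (ae_of_all _ fun x => mul_log_clampPos_sub_nonneg n _),
    integral_sub hlog (hclamp.sub' (integrable_const 1)), klDual, ← integral_rnDeriv_smul hac]
  simp only [smul_eq_mul, hr, Real.exp_log (clampPos_pos n _)]

theorem klDiv_le_ofReal_of_klDual_le {L : ℝ}
    (h : ∀ (f : S → ℝ) (c : ℝ), Measurable f → (∀ x, |f x| ≤ c) → klDual μ ν f ≤ L) :
    klDiv μ ν ≤ ENNReal.ofReal L := by
  have hac := absolutelyContinuous_of_klDual_le h
  have hlim (x : S) := (ENNReal.continuous_ofReal.tendsto _).comp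
    (tendsto_mul_log_clampPos (r := (μ.rnDeriv ν x).toReal) ENNReal.toReal_nonneg)
  rw [klDiv_eq_lintegral_klFun_of_ac hac, ← lintegral_congr fun x => (hlim x).liminf_eq]
  refine (lintegral_liminf_le fun n => ?_).trans
    (liminf_le_of_frequently_le' <| .of_forall fun n => ?_)
  · simp only [Function.comp_def]
    fun_prop
  · simp only [Function.comp_def, ← ofReal_klDual_log_clampPos hac]
    refine ENNReal.ofReal_le_ofReal (h _ (Real.log (n + 1)) ?_ fun x => abs_log_clampPos_le n _)
    exact (measurable_log_clampPos n).comp (by fun_prop)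

variable [TopologicalSpace S] [TopologicalSpace.PseudoMetrizableSpace S] [BorelSpace S]

theorem exists_boundedContinuous_abs_le_integral_abs_sub_le {f : S → ℝ} (hf : Measurable f)
    {c : ℝ} (hfc : ∀ x, |f x| ≤ c) {ε : ℝ} (hε : 0 < ε) :
    ∃ g : S →ᵇ ℝ, (∀ x, |g x| ≤ c) ∧ ∫ x, |f x - g x| ∂μ ≤ ε := by
  have hfi : Integrable f μ := .of_bound hf.aestronglyMeasurable c (ae_of_all _ hfc)
  obtain ⟨g, hg, hgi⟩ := hfi.exists_boundedContinuous_integral_sub_le hε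
  have hclamp (x : S) : |max (-c) (min (g x) c)| ≤ c :=
    abs_le.2 ⟨le_max_left _ _, max_le ((neg_nonpos.2 ((abs_nonneg _).trans (hfc x))).trans
      ((abs_nonneg _).trans (hfc x))) (min_le_right _ _)⟩
  refine ⟨.ofNormedAddCommGroup (fun x => max (-c) (min (g x) c)) (by fun_prop) c hclamp, hclamp,
    (integral_mono_of_nonneg (ae_of_all _ fun x => abs_nonneg _) (hfi.sub hgi).norm
      (ae_of_all _ fun x => ?_)).trans hg⟩
  have hfx : f x = max (-c) (min (f x) c) := by
    rw [min_eq_left (abs_le.1 (hfc x)).2, max_eq_right (abs_le.1 (hfc x)).1]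
  calc |f x - max (-c) (min (g x) c)|
      = |max (-c) (min (f x) c) - max (-c) (min (g x) c)| := by rw [← hfx]
    _ ≤ |min (f x) c - min (g x) c| := by
        simpa only [max_comm (-c)] using abs_sup_sub_sup_le_abs (min (f x) c) (min (g x) c) (-c)
    _ ≤ |f x - g x| := abs_inf_sub_inf_le_abs _ _ _

theorem klDual_le_of_forall_boundedContinuous {L : ℝ} (h : ∀ g : S →ᵇ ℝ, klDual μ ν g ≤ L)
    {f : S → ℝ} (hf : Measurable f) {c : ℝ} (hfc : ∀ x, |f x| ≤ c) : klDual μ ν f ≤ L := by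
  refine le_of_forall_pos_le_add fun δ hδ => ?_
  have hpos : 0 < 1 + Real.exp c := by positivity
  obtain ⟨g, hgc, hg⟩ := exists_boundedContinuous_abs_le_integral_abs_sub_le (μ := μ + ν) hf hfc
    (div_pos hδ hpos)
  have hgm : Measurable g := g.continuous.measurable
  have hd (ρ : Measure S) [IsFiniteMeasure ρ] : Integrable (fun x => |f x - g x|) ρ :=
    ((Integrable.of_bound hf.aestronglyMeasurable c (ae_of_all _ hfc)).sub
      (g.integrable ρ)).abs
  rw [integral_add_measure (hd μ) (hd ν)] at hg
  have hμ : 0 ≤ ∫ x, |f x - g x| ∂μ := integral_nonneg fun x => abs_nonneg _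
  have hν : 0 ≤ ∫ x, |f x - g x| ∂ν := integral_nonneg fun x => abs_nonneg _
  calc klDual μ ν f
      ≤ klDual μ ν g + (∫ x, |f x - g x| ∂μ + Real.exp c * ∫ x, |f x - g x| ∂ν) :=
        klDual_le_klDual_add hf hgm hfc hgc
    _ ≤ L + (1 + Real.exp c) * (∫ x, |f x - g x| ∂μ + ∫ x, |f x - g x| ∂ν) := by
        have := mul_nonneg (Real.exp_pos c).le hμ
        linarith [h g]
    _ ≤ L + (1 + Real.exp c) * (δ / (1 + Real.exp c)) := by gcongr
    _ = L + δ := by rw [mul_div_cancel₀ _ hpos.ne']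

theorem klDiv_eq_iSup_boundedContinuous (μ ν : Measure S) [IsFiniteMeasure μ]
    [IsFiniteMeasure ν] : klDiv μ ν = ⨆ f : S →ᵇ ℝ, ENNReal.ofReal (klDual μ ν f) := by
  refine le_antisymm ?_ <| iSup_le fun f => ofReal_klDual_le_klDiv (f.integrable μ)
    (integrable_exp_of_abs_le f.continuous.measurable f.norm_coe_le_norm)
  rcases eq_or_ne (⨆ f : S →ᵇ ℝ, ENNReal.ofReal (klDual μ ν f)) ⊤ with htop | hne
  · exact htop ▸ le_top
  rw [← ENNReal.ofReal_toReal hne]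
  exact klDiv_le_ofReal_of_klDual_le fun f c hf hfc => klDual_le_of_forall_boundedContinuous
    (fun g => (ENNReal.ofReal_le_iff_le_toReal hne).1
      (le_iSup (fun g : S →ᵇ ℝ => ENNReal.ofReal (klDual μ ν g)) g)) hf hfc

theorem lowerSemicontinuous_klDiv : LowerSemicontinuous
    fun p : FiniteMeasure S × FiniteMeasure S => klDiv (p.1 : Measure S) p.2 := by
  simp_rw [klDiv_eq_iSup_boundedContinuous]
  refine lowerSemicontinuous_iSup fun f => Continuous.lowerSemicontinuous ?_
  have hint (g : S →ᵇ ℝ) : Continuous fun ρ : FiniteMeasure S => ∫ x, g x ∂(ρ : Measure S) :=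
    continuous_iff_continuousAt.2 fun ρ =>
      FiniteMeasure.tendsto_iff_forall_integral_tendsto.1 tendsto_id g
  have hexp (x : S) : ‖Real.exp (f x) - 1‖ ≤ Real.exp ‖f‖ + 1 := by
    refine (norm_sub_le _ _).trans ?_
    rw [Real.norm_eq_abs, Real.abs_exp, norm_one]
    gcongr
    exact (le_abs_self _).trans (f.norm_coe_le_norm x)
  have hexp_sub_one := hint <|
    .ofNormedAddCommGroup (fun x => Real.exp (f x) - 1) (by fun_prop) _ hexp
  exact ENNReal.continuous_ofReal.comp
    (((hint f).comp continuous_fst).sub (hexp_sub_one.comp continuous_snd))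

end KullbackLeibler

section ConditionalDivergence

theorem klDiv_map_measurableEquiv {S T : Type*} [MeasurableSpace S] [MeasurableSpace T]
    (μ ν : Measure S) [IsFiniteMeasure μ] [IsFiniteMeasure ν] (e : S ≃ᵐ T) :
    klDiv (μ.map e) (ν.map e) = klDiv μ ν := by
  refine le_antisymm (klDiv_map_le _ _ e.measurable) ?_
  simpa only [MeasurableEquiv.map_symm_map] using
    klDiv_map_le (μ.map e) (ν.map e) e.symm.measurable

variable {T S : Type*} [MeasurableSpace T] [MeasurableSpace S]
  [MeasurableSpace.CountableOrCountablyGenerated T S] {κ η : Kernel T S} [IsFiniteKernel κ]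
  [IsFiniteKernel η]

theorem klDiv_eq_lintegral_klFun_kernel {y : T} (hy : κ y ≪ η y) :
    klDiv (κ y) (η y) = ∫⁻ x, ENNReal.ofReal (klFun (κ.rnDeriv η y x).toReal) ∂(η y) := by
  rw [klDiv_eq_lintegral_klFun_of_ac hy]
  exact lintegral_congr_ae <| (Kernel.rnDeriv_eq_rnDeriv_measure (κ := κ)).mono
    fun x hx => by simp only [hx]

theorem measurable_klDiv_kernel : Measurable fun y => klDiv (κ y) (η y) := by
  classical
  have hpiecewise : (fun y => klDiv (κ y) (η y)) = {y | κ y ≪ η y}.piecewise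
      (fun y => ∫⁻ x, ENNReal.ofReal (klFun (κ.rnDeriv η y x).toReal) ∂(η y)) fun _ => ⊤ := by
    ext y
    by_cases hy : κ y ≪ η y
    · rw [Set.piecewise_eq_of_mem _ _ _ hy, klDiv_eq_lintegral_klFun_kernel hy]
    · rw [Set.piecewise_eq_of_notMem _ _ _ hy, klDiv_of_not_ac hy]
  rw [hpiecewise]
  refine Measurable.piecewise (Kernel.measurableSet_absolutelyContinuous κ η) ?_ measurable_const
  exact Measurable.lintegral_kernel_prod_right'
    (f := fun p : T × S => ENNReal.ofReal (klFun (κ.rnDeriv η p.1 p.2).toReal)) (by fun_prop)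

variable {μ : Measure T} [IsFiniteMeasure μ]

theorem compProd_eq_withDensity_rnDeriv (hac : ∀ᵐ y ∂μ, κ y ≪ η y) :
    μ ⊗ₘ κ = (μ ⊗ₘ η).withDensity fun p => κ.rnDeriv η p.1 p.2 := by
  rw [← Measure.compProd_withDensity (Kernel.measurable_rnDeriv κ η)]
  refine Measure.compProd_congr ?_
  filter_upwards [hac] with y hy
  exact (Kernel.withDensity_rnDeriv_eq hy).symm

theorem klDiv_compProd_right_of_ac (hac : ∀ᵐ y ∂μ, κ y ≪ η y) :
    klDiv (μ ⊗ₘ κ) (μ ⊗ₘ η) = ∫⁻ y, klDiv (κ y) (η y) ∂μ := by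
  have hm : Measurable fun p : T × S => κ.rnDeriv η p.1 p.2 := Kernel.measurable_rnDeriv κ η
  have hrnDeriv : (μ ⊗ₘ κ).rnDeriv (μ ⊗ₘ η) =ᵐ[μ ⊗ₘ η] fun p => κ.rnDeriv η p.1 p.2 := by
    rw [compProd_eq_withDensity_rnDeriv hac]
    exact Measure.rnDeriv_withDensity _ hm
  calc klDiv (μ ⊗ₘ κ) (μ ⊗ₘ η)
      = ∫⁻ p, ENNReal.ofReal (klFun (κ.rnDeriv η p.1 p.2).toReal) ∂(μ ⊗ₘ η) := by
        rw [klDiv_eq_lintegral_klFun_of_ac (Measure.absolutelyContinuous_compProd_right_iff.2 hac)]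
        exact lintegral_congr_ae (hrnDeriv.mono fun p hp => by simp only [hp])
    _ = ∫⁻ y, ∫⁻ x, ENNReal.ofReal (klFun (κ.rnDeriv η y x).toReal) ∂(η y) ∂μ :=
        Measure.lintegral_compProd (by fun_prop)
    _ = ∫⁻ y, klDiv (κ y) (η y) ∂μ :=
        lintegral_congr_ae (hac.mono fun y hy => (klDiv_eq_lintegral_klFun_kernel hy).symm)

theorem klDiv_compProd_right [∀ y, NeZero (κ y)] :
    klDiv (μ ⊗ₘ κ) (μ ⊗ₘ η) = ∫⁻ y, klDiv (κ y) (η y) ∂μ := by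
  by_cases hac : ∀ᵐ y ∂μ, κ y ≪ η y
  · exact klDiv_compProd_right_of_ac hac
  rw [klDiv_of_not_ac (mt Measure.absolutelyContinuous_compProd_right_iff.1 hac), eq_comm,
    eq_top_iff]
  have hs : MeasurableSet {y | ¬ κ y ≪ η y} := (Kernel.measurableSet_absolutelyContinuous κ η).compl
  calc ⊤ = ∫⁻ _ in {y | ¬ κ y ≪ η y}, ⊤ ∂μ := by
        rw [setLIntegral_const, ENNReal.top_mul (mt ae_iff.2 hac)]
    _ = ∫⁻ y in {y | ¬ κ y ≪ η y}, klDiv (κ y) (η y) ∂μ :=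
        setLIntegral_congr_fun hs fun _ hy => (klDiv_of_not_ac hy).symm
    _ ≤ ∫⁻ y, klDiv (κ y) (η y) ∂μ := setLIntegral_le_lintegral _ _

end ConditionalDivergence

section Gaussian

variable {E : Type*} [NormedAddCommGroup E] [InnerProductSpace ℝ E]

/-- Lebesgue density of the standard Gaussian measure on a finite-dimensional inner product
space. -/
def stdGaussianDensity (z : E) : ℝ :=
  ((2 * Real.pi) ^ (Module.finrank ℝ E / 2 : ℝ))⁻¹ * Real.exp (-‖z‖ ^ 2 / 2)

theorem stdGaussianDensity_nonneg (z : E) : 0 ≤ stdGaussianDensity z := by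
  unfold stdGaussianDensity; positivity

@[fun_prop]
theorem continuous_stdGaussianDensity : Continuous (stdGaussianDensity (E := E)) := by
  unfold stdGaussianDensity; fun_prop

theorem stdGaussianDensity_sub (h z : E) :
    stdGaussianDensity (z - h) = stdGaussianDensity z * Real.exp (⟪h, z⟫ - ‖h‖ ^ 2 / 2) := by
  rw [stdGaussianDensity, stdGaussianDensity, mul_assoc, ← Real.exp_add, norm_sub_sq_real,
    real_inner_comm]
  ring_nf

theorem hasLineDerivAt_stdGaussianDensity (z e : E) :
    HasLineDerivAt ℝ stdGaussianDensity (-(⟪e, z⟫ * stdGaussianDensity z)) z e := by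
  have h := ((hasDerivAt_id (0 : ℝ)).smul_const e).const_add z |>.norm_sq
  refine ((h.neg.div_const 2).exp.const_mul _).congr_deriv ?_
  simp only [id_eq, Pi.neg_apply, zero_smul, add_zero, one_smul, real_inner_comm e z,
    stdGaussianDensity]
  ring

variable [FiniteDimensional ℝ E] [MeasurableSpace E] [BorelSpace E]

theorem integral_exp_inner_mul_stdGaussianDensity (t : E) :
    ∫ z : E, (stdGaussianDensity z : ℂ) * Complex.exp (⟪z, t⟫ * Complex.I) =
      Complex.exp (-‖t‖ ^ 2 / 2) := by
  have h := GaussianFourier.integral_cexp_neg_mul_sq_norm_add (b := 1 / 2) (by norm_num)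
    Complex.I t
  have hterm (z : E) : (stdGaussianDensity z : ℂ) * Complex.exp (⟪z, t⟫ * Complex.I) =
      (((2 * Real.pi) ^ (Module.finrank ℝ E / 2 : ℝ))⁻¹ : ℝ) *
        Complex.exp (-(1 / 2) * (‖z‖ : ℂ) ^ 2 + Complex.I * ⟪t, z⟫) := by
    rw [stdGaussianDensity, Complex.ofReal_mul, mul_assoc, Complex.ofReal_exp, ← Complex.exp_add,
      real_inner_comm]
    push_cast
    ring_nf
  have hnorm : (((2 * Real.pi) ^ (Module.finrank ℝ E / 2 : ℝ) : ℝ) : ℂ) =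
      (Real.pi / (1 / 2)) ^ (Module.finrank ℝ E / 2 : ℂ) := by
    rw [Complex.ofReal_cpow (by positivity)]
    push_cast
    ring_nf
  have hne : (((2 * Real.pi) ^ (Module.finrank ℝ E / 2 : ℝ) : ℝ) : ℂ) ≠ 0 :=
    Complex.ofReal_ne_zero.2 (by positivity)
  simp_rw [hterm, integral_const_mul, h, ← hnorm, Complex.ofReal_inv]
  rw [inv_mul_cancel_left₀ hne, Complex.I_sq]
  ring_nf

theorem stdGaussian_eq_withDensity :
    stdGaussian E = volume.withDensity fun z => ENNReal.ofReal (stdGaussianDensity z) := by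
  have hint : Integrable (stdGaussianDensity (E := E)) := by
    have h := GaussianFourier.integrable_cexp_neg_mul_sq_norm_add (V := E) (b := 1 / 2)
      (by norm_num) 0 0
    refine Integrable.const_mul (h.norm.congr (.of_forall fun z => ?_)) _
    have hexp : -(1 / 2) * (‖z‖ : ℂ) ^ 2 = ((-‖z‖ ^ 2 / 2 : ℝ) : ℂ) := by push_cast; ring
    simp only [zero_mul, add_zero, hexp, Complex.norm_exp_ofReal]
  have := isFiniteMeasure_withDensity_ofReal hint.2
  refine Measure.ext_of_charFun (funext fun t => ?_)
  rw [charFun_stdGaussian, charFun_apply, integral_withDensity_eq_integral_toReal_smul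
    (by fun_prop) (by simp)]
  simp only [ENNReal.toReal_ofReal (stdGaussianDensity_nonneg _), Complex.real_smul,
    integral_exp_inner_mul_stdGaussianDensity]

theorem integrable_stdGaussian_iff {f : E → ℝ} :
    Integrable f (stdGaussian E) ↔ Integrable fun z => stdGaussianDensity z * f z := by
  rw [stdGaussian_eq_withDensity, integrable_withDensity_iff_integrable_smul' (by fun_prop)
    (by simp)]
  simp only [ENNReal.toReal_ofReal (stdGaussianDensity_nonneg _), smul_eq_mul]

theorem integral_stdGaussian_eq (f : E → ℝ) :
    ∫ z, f z ∂(stdGaussian E) = ∫ z, stdGaussianDensity z * f z := by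
  rw [stdGaussian_eq_withDensity, integral_withDensity_eq_integral_toReal_smul
    (by fun_prop) (by simp)]
  simp only [ENNReal.toReal_ofReal (stdGaussianDensity_nonneg _), smul_eq_mul]

theorem lintegral_add_left_stdGaussian (h : E) {f : E → ℝ≥0∞} (hf : Measurable f) :
    ∫⁻ z, f (h + z) ∂(stdGaussian E) =
      ∫⁻ z, ENNReal.ofReal (Real.exp (⟪h, z⟫ - ‖h‖ ^ 2 / 2)) * f z ∂(stdGaussian E) := by
  rw [stdGaussian_eq_withDensity,
    lintegral_withDensity_eq_lintegral_mul _ (by fun_prop) (by fun_prop),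
    lintegral_withDensity_eq_lintegral_mul _ (by fun_prop) (by fun_prop)]
  have hshift := lintegral_add_left_eq_self (μ := volume)
    (fun z => ENNReal.ofReal (stdGaussianDensity (z - h)) * f z) h
  simp only [add_sub_cancel_left] at hshift
  simpa only [Pi.mul_apply, stdGaussianDensity_sub, ENNReal.ofReal_mul
    (stdGaussianDensity_nonneg _), mul_assoc] using hshift

theorem integral_inner_mul_stdGaussian (e : E) {φ φ' : E → ℝ}
    (hd : ∀ z, HasLineDerivAt ℝ φ (φ' z) z e) (hφ : Integrable φ (stdGaussian E))
    (hφ' : Integrable φ' (stdGaussian E))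
    (hφe : Integrable (fun z => ⟪e, z⟫ * φ z) (stdGaussian E)) :
    ∫ z, ⟪e, z⟫ * φ z ∂(stdGaussian E) = ∫ z, φ' z ∂(stdGaussian E) := by
  rw [integrable_stdGaussian_iff] at hφ hφ' hφe
  have h := integral_bilinear_hasLineDerivAt_right_eq_neg_left_of_integrable (μ := volume)
    (v := e) (B := ContinuousLinearMap.mul ℝ ℝ) (f := stdGaussianDensity)
    (f' := fun z => -(⟪e, z⟫ * stdGaussianDensity z)) (g := φ) (g' := φ')
    (by simpa [mul_left_comm, mul_assoc] using hφe.neg) hφ' hφ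
    (fun z _ => hasLineDerivAt_stdGaussianDensity z e) fun z _ => hd z
  simp only [ContinuousLinearMap.mul_apply', neg_mul, integral_neg, neg_neg] at h
  simp only [integral_stdGaussian_eq, h, mul_left_comm, mul_assoc]

end Gaussian

section Posterior

theorem integral_le_integral_tilted {S : Type*} [MeasurableSpace S] {μ : Measure S}
    [IsProbabilityMeasure μ] {g : S → ℝ} (hg : Integrable g μ)
    (hexp : Integrable (fun x => Real.exp (g x)) μ)
    (hmul : Integrable (fun x => Real.exp (g x) * g x) μ) :
    ∫ x, g x ∂μ ≤ ∫ x, g x ∂(μ.tilted g) := by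
  set c := ∫ x, g x ∂μ
  -- Chebyshev's association inequality for the two increasing functions `id` and `exp` of `g`.
  have hcheb : 0 ≤ ∫ x, (g x - c) * (Real.exp (g x) - Real.exp c) ∂μ := by
    refine integral_nonneg fun x => ?_
    rcases le_total (g x) c with h | h
    · exact mul_nonneg_of_nonpos_of_nonpos (by linarith) (by linarith [Real.exp_le_exp.2 h])
    · exact mul_nonneg (by linarith) (by linarith [Real.exp_le_exp.2 h])
  have hsplit : ∫ x, (g x - c) * (Real.exp (g x) - Real.exp c) ∂μ =
      ∫ x, Real.exp (g x) * g x ∂μ - c * ∫ x, Real.exp (g x) ∂μ := by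
    have hcenter : ∫ x, (g x - c) * Real.exp c ∂μ = 0 := by
      simp [integral_mul_const, integral_sub hg (integrable_const c), c]
    have hexpand (x : S) : (g x - c) * (Real.exp (g x) - Real.exp c) =
        Real.exp (g x) * g x - c * Real.exp (g x) - (g x - c) * Real.exp c := by ring
    simp_rw [hexpand]
    have hmulsub := hmul.sub (hexp.const_mul c)
    have hgsub := (hg.sub (integrable_const c)).mul_const (Real.exp c)
    simp only [Pi.sub_def] at hmulsub hgsub
    rw [integral_sub hmulsub hgsub, hcenter, sub_zero, integral_sub hmul (hexp.const_mul c),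
      integral_const_mul]
  simp_rw [integral_tilted, div_eq_inv_mul, smul_eq_mul, mul_assoc]
  rw [integral_const_mul, le_inv_mul_iff₀ (integral_exp_pos hexp)]
  linarith

theorem hasDerivAt_integral_tilted_mul_self {S : Type*} [MeasurableSpace S] {μ : Measure S}
    {X : S → ℝ} {t : ℝ} (ht : t ∈ interior (integrableExpSet X μ)) :
    HasDerivAt (fun s => ∫ x, X x ∂(μ.tilted (s * X ·))) Var[X; μ.tilted (t * X ·)] t := by
  have hderiv : HasDerivAt (deriv (cgf X μ)) (iteratedDeriv 2 (cgf X μ) t) t := by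
    rw [iteratedDeriv_succ, iteratedDeriv_one]
    exact (analyticAt_cgf ht).deriv.differentiableAt.hasDerivAt
  rw [variance_tilted_mul ht]
  exact hderiv.congr_of_eventuallyEq <| Filter.mem_of_superset (isOpen_interior.mem_nhds ht)
    fun s hs => integral_tilted_mul_self hs

theorem integrable_norm_sq_of_memLp_id {E : Type*} [NormedAddCommGroup E] [MeasurableSpace E]
    {B : Measure E} (hB : MemLp id 2 B) :
    Integrable (fun x => ‖x‖ ^ 2) B :=
  hB.integrable_norm_pow two_ne_zero

theorem integrable_id_of_memLp_two {E : Type*} [NormedAddCommGroup E] [MeasurableSpace E]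
    {B : Measure E} [IsFiniteMeasure B] (hB : MemLp id 2 B) :
    Integrable (fun x => x) B :=
  hB.integrable one_le_two

variable {E : Type*} [NormedAddCommGroup E] [InnerProductSpace ℝ E]

/-- Logarithm of the likelihood of the observation `z = a • x + n` of a signal `x` in standard
Gaussian noise `n`, relative to the law of pure noise. -/
def logLikelihood (a : ℝ) (z x : E) : ℝ := a * ⟪z, x⟫ - a ^ 2 * ‖x‖ ^ 2 / 2

theorem logLikelihood_eq (a : ℝ) (z x : E) :
    logLikelihood a z x = ‖z‖ ^ 2 / 2 - ‖z - a • x‖ ^ 2 / 2 := by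
  rw [logLikelihood, norm_sub_sq_real, norm_smul, real_inner_smul_right, mul_pow,
    Real.norm_eq_abs, sq_abs]
  ring

theorem logLikelihood_le (a : ℝ) (z x : E) : logLikelihood a z x ≤ ‖z‖ ^ 2 / 2 := by
  rw [logLikelihood_eq]
  linarith [sq_nonneg ‖z - a • x‖]

theorem neg_le_logLikelihood (a : ℝ) (z x : E) :
    -(‖z‖ ^ 2 / 2 + a ^ 2 * ‖x‖ ^ 2) ≤ logLikelihood a z x := by
  have h := sq_nonneg ‖z + a • x‖
  rw [norm_add_sq_real, norm_smul, real_inner_smul_right, mul_pow, Real.norm_eq_abs, sq_abs] at h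
  rw [logLikelihood]
  linarith

theorem logLikelihood_le_sub (a : ℝ) (z x : E) :
    logLikelihood a z x ≤ ‖z‖ ^ 2 - a ^ 2 * ‖x‖ ^ 2 / 4 := by
  have h := sq_nonneg ‖z - (a / 2) • x‖
  rw [norm_sub_sq_real, norm_smul, real_inner_smul_right, mul_pow, Real.norm_eq_abs, sq_abs] at h
  rw [logLikelihood]
  linarith

theorem logLikelihood_add_smul (a s : ℝ) (z e x : E) :
    logLikelihood a (z + s • e) x = logLikelihood a z x + a * s * ⟪e, x⟫ := by
  rw [logLikelihood, logLikelihood, inner_add_left, real_inner_smul_left]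
  ring

@[fun_prop]
theorem continuous_logLikelihood {S : Type*} [TopologicalSpace S] {a : S → ℝ} {z x : S → E}
    (ha : Continuous a) (hz : Continuous z) (hx : Continuous x) :
    Continuous fun s => logLikelihood (a s) (z s) (x s) := by
  unfold logLikelihood; fun_prop

theorem hasDerivAt_logLikelihood_path (a : ℝ) (x n u : E) :
    HasDerivAt (fun a : ℝ => logLikelihood a (a • x + n) u)
      (⟪n + (2 * a) • x, u⟫ - a * ‖u‖ ^ 2) a := by
  simp_rw [logLikelihood, inner_add_left, real_inner_smul_left]
  refine (((hasDerivAt_id a).mul (((hasDerivAt_id a).mul_const ⟪x, u⟫).add_const ⟪n, u⟫)).sub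
    ((((hasDerivAt_id a).pow 2).mul_const (‖u‖ ^ 2)).div_const 2)).congr_deriv ?_
  simp only [id_eq, one_mul, Nat.cast_ofNat, Nat.add_one_sub_one, pow_one, mul_one]
  ring

theorem abs_logLikelihood_path_deriv_le {a b : ℝ} (hab : |a| ≤ b) (x n u : E) :
    |⟪n + (2 * a) • x, u⟫ - a * ‖u‖ ^ 2| ≤ (‖n‖ + 2 * b * ‖x‖) * ‖u‖ + b * ‖u‖ ^ 2 := by
  calc |⟪n + (2 * a) • x, u⟫ - a * ‖u‖ ^ 2|
      ≤ ‖n + (2 * a) • x‖ * ‖u‖ + |a| * ‖u‖ ^ 2 := by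
        refine (abs_sub _ _).trans (add_le_add (abs_real_inner_le_norm _ _) ?_)
        rw [abs_mul, abs_of_nonneg (sq_nonneg ‖u‖)]
    _ ≤ (‖n‖ + 2 * b * ‖x‖) * ‖u‖ + b * ‖u‖ ^ 2 := by
        gcongr
        refine (norm_add_le _ _).trans ?_
        rw [norm_smul, norm_mul, Real.norm_ofNat, Real.norm_eq_abs]
        gcongr

variable [MeasurableSpace E]

/-- The density at `z`, relative to the standard Gaussian measure, of the law of `a • X + N` for
`X ∼ B` and an independent standard Gaussian `N`. -/
def evidence (B : Measure E) (a : ℝ) (z : E) : ℝ := ∫ x, Real.exp (logLikelihood a z x) ∂B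

/-- The conditional law of `X` given `a • X + N = z`, for `X ∼ B` and an independent standard
Gaussian `N`. -/
def posterior (B : Measure E) (a : ℝ) (z : E) : Measure E := B.tilted (logLikelihood a z)

/-- The conditional expectation of `X` given `a • X + N = z`, for `X ∼ B` and an independent
standard Gaussian `N`. -/
def posteriorMean (B : Measure E) (a : ℝ) (z : E) : E := ∫ x, x ∂(posterior B a z)

/-- The conditional expectation of `‖X‖ ^ 2` given `a • X + N = z`, for `X ∼ B` and an independent
standard Gaussian `N`. -/
def posteriorSqNorm (B : Measure E) (a : ℝ) (z : E) : ℝ := ∫ x, ‖x‖ ^ 2 ∂(posterior B a z)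

theorem integral_posterior {F : Type*} [NormedAddCommGroup F] [NormedSpace ℝ F] (B : Measure E)
    (a : ℝ) (z : E) (f : E → F) :
    ∫ x, f x ∂(posterior B a z) =
      ∫ x, (Real.exp (logLikelihood a z x) / evidence B a z) • f x ∂B :=
  integral_tilted _ _

theorem integrable_logLikelihood {B : Measure E} [IsFiniteMeasure B] (hB : MemLp id 2 B) (a : ℝ)
    (z : E) : Integrable (logLikelihood a z) B :=
  (((integrable_id_of_memLp_two hB).const_inner z).const_mul a).sub
    (((integrable_norm_sq_of_memLp_id hB).const_mul (a ^ 2)).div_const 2)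

theorem neg_le_integral_logLikelihood {B : Measure E} [IsProbabilityMeasure B]
    (hB : MemLp id 2 B) (a : ℝ) (z : E) :
    -(‖z‖ ^ 2 / 2 + a ^ 2 * ∫ x, ‖x‖ ^ 2 ∂B) ≤ ∫ x, logLikelihood a z x ∂B := by
  have hsq := (integrable_norm_sq_of_memLp_id hB).const_mul (a ^ 2)
  calc -(‖z‖ ^ 2 / 2 + a ^ 2 * ∫ x, ‖x‖ ^ 2 ∂B)
      = ∫ x, -(‖z‖ ^ 2 / 2 + a ^ 2 * ‖x‖ ^ 2) ∂B := by
        rw [integral_neg, integral_add (integrable_const _) hsq, integral_const_mul]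
        simp
    _ ≤ ∫ x, logLikelihood a z x ∂B :=
        integral_mono ((integrable_const _).add hsq).neg (integrable_logLikelihood hB a z)
          (neg_le_logLikelihood a z)

variable (B : Measure E)

theorem memLp_posterior {F : Type*} [NormedAddCommGroup F] {f : E → F} {p : ℝ≥0∞}
    (hf : MemLp f p B) (a : ℝ) (z : E) : MemLp f p (posterior B a z) := by
  refine hf.of_measure_le_smul
    (c := ENNReal.ofReal (Real.exp (‖z‖ ^ 2 / 2) / evidence B a z)) ENNReal.ofReal_ne_top ?_
  rw [← withDensity_const]
  refine withDensity_mono (ae_of_all _ fun x => ENNReal.ofReal_le_ofReal ?_)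
  exact div_le_div_of_nonneg_right (Real.exp_le_exp.2 (logLikelihood_le a z x))
    (integral_nonneg fun x => (Real.exp_pos _).le)

theorem integrable_posterior {F : Type*} [NormedAddCommGroup F] {f : E → F}
    (hf : Integrable f B) (a : ℝ) (z : E) : Integrable f (posterior B a z) :=
  memLp_one_iff_integrable.1 (memLp_posterior B (memLp_one_iff_integrable.2 hf) a z)

theorem inner_posteriorMean [CompleteSpace E] {B : Measure E} [IsFiniteMeasure B]
    (hB : MemLp id 2 B) (a : ℝ) (z e : E) :
    ⟪e, posteriorMean B a z⟫ = ∫ x, ⟪e, x⟫ ∂(posterior B a z) :=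
  (integral_inner (integrable_posterior B (integrable_id_of_memLp_two hB) a z) e).symm

variable [BorelSpace E] [IsFiniteMeasure B]

theorem integrable_exp_logLikelihood (a : ℝ) (z : E) :
    Integrable (fun x => Real.exp (logLikelihood a z x)) B :=
  .of_bound (Continuous.aestronglyMeasurable (by fun_prop)) (Real.exp (‖z‖ ^ 2 / 2))
    (ae_of_all _ fun x => by simpa using logLikelihood_le a z x)

theorem evidence_pos [NeZero B] (a : ℝ) (z : E) : 0 < evidence B a z :=
  integral_exp_pos (integrable_exp_logLikelihood B a z)

instance isProbabilityMeasure_posterior [NeZero B] (a : ℝ) (z : E) :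
    IsProbabilityMeasure (posterior B a z) :=
  isProbabilityMeasure_tilted (integrable_exp_logLikelihood B a z)

theorem posterior_add_smul (a s : ℝ) (z e : E) :
    posterior B a (z + s • e) = (posterior B a z).tilted (a * s * ⟪e, ·⟫) := by
  rw [posterior, posterior, tilted_tilted (integrable_exp_logLikelihood B a z)]
  exact congrArg _ (funext fun x => logLikelihood_add_smul a s z e x)

theorem integrableExpSet_inner_posterior {a : ℝ} (ha : a ≠ 0) (z e : E) :
    integrableExpSet (⟪e, ·⟫) (posterior B a z) = Set.univ := by
  refine Set.eq_univ_of_forall fun t => ?_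
  refine (integrable_tilted_iff (integrable_exp_logLikelihood B a z) _).2 ?_
  refine (integrable_exp_logLikelihood B a (z + (t / a) • e)).congr (ae_of_all _ fun x => ?_)
  simp only [logLikelihood_add_smul, mul_div_cancel₀ t ha, Real.exp_add, smul_eq_mul]

variable {B}

theorem hasLineDerivAt_inner_posteriorMean [CompleteSpace E] [NeZero B] (hB : MemLp id 2 B)
    {a : ℝ} (ha : a ≠ 0) (z e : E) :
    HasLineDerivAt ℝ (fun z => ⟪e, posteriorMean B a z⟫)
      (a * Var[(⟪e, ·⟫); posterior B a z]) z e := by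
  have h := hasDerivAt_integral_tilted_mul_self (X := (⟪e, ·⟫)) (μ := posterior B a z)
    (t := a * 0) (by simp [integrableExpSet_inner_posterior B ha])
  simp only [HasLineDerivAt, inner_posteriorMean hB, posterior_add_smul]
  refine (h.comp 0 ((hasDerivAt_id (0 : ℝ)).const_mul a)).congr_deriv ?_
  simp [mul_comm]

theorem norm_posteriorMean_sq_le [CompleteSpace E] [NeZero B] (hB : MemLp id 2 B) (a : ℝ) (z : E) :
    ‖posteriorMean B a z‖ ^ 2 ≤ posteriorSqNorm B a z :=
  (convexOn_univ_norm.pow (fun _ _ => norm_nonneg _) 2).map_integral_le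
    (by fun_prop) isClosed_univ (by simp)
    (integrable_posterior B (integrable_id_of_memLp_two hB) a z)
    (integrable_posterior B (integrable_norm_sq_of_memLp_id hB) a z)

theorem hasDerivAt_evidence_path (hB : MemLp id 2 B) (a : ℝ) (x n : E) :
    HasDerivAt (fun a : ℝ => evidence B a (a • x + n))
      (∫ u, Real.exp (logLikelihood a (a • x + n) u) *
        (⟪n + (2 * a) • x, u⟫ - a * ‖u‖ ^ 2) ∂B) a := by
  set c := |a| + 1
  have hbound (u : E) (s : ℝ) (hs : s ∈ Metric.ball a 1) :
      ‖Real.exp (logLikelihood s (s • x + n) u) * (⟪n + (2 * s) • x, u⟫ - s * ‖u‖ ^ 2)‖ ≤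
        Real.exp ((c * ‖x‖ + ‖n‖) ^ 2 / 2) * ((‖n‖ + 2 * c * ‖x‖) * ‖u‖ + c * ‖u‖ ^ 2) := by
    have hsc : |s| ≤ c := by
      have hdist : |s - a| < 1 := hs
      linarith [abs_sub_abs_le_abs_sub s a]
    have hpath : ‖s • x + n‖ ≤ c * ‖x‖ + ‖n‖ := by
      refine (norm_add_le _ _).trans ?_
      rw [norm_smul, Real.norm_eq_abs]
      gcongr
    rw [norm_mul, Real.norm_of_nonneg (Real.exp_pos _).le, Real.norm_eq_abs]
    gcongr
    · exact (logLikelihood_le _ _ _).trans (by gcongr)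
    · exact abs_logLikelihood_path_deriv_le hsc x n u
  refine (hasDerivAt_integral_of_dominated_loc_of_deriv_le (Metric.ball_mem_nhds a one_pos)
    (.of_forall fun s => (integrable_exp_logLikelihood B s (s • x + n)).1)
    (integrable_exp_logLikelihood B _ _) (Continuous.aestronglyMeasurable (by fun_prop))
    (ae_of_all _ hbound) (((integrable_id_of_memLp_two hB).norm.const_mul _).add
      ((integrable_norm_sq_of_memLp_id hB).const_mul _) |>.const_mul _)
    (ae_of_all _ fun u s _ => (hasDerivAt_logLikelihood_path s x n u).exp)).2

theorem hasDerivAt_log_evidence_path [CompleteSpace E] [NeZero B] (hB : MemLp id 2 B)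
    (a : ℝ) (x n : E) :
    HasDerivAt (fun a : ℝ => Real.log (evidence B a (a • x + n)))
      (⟪n + (2 * a) • x, posteriorMean B a (a • x + n)⟫ -
        a * posteriorSqNorm B a (a • x + n)) a := by
  refine ((hasDerivAt_evidence_path hB a x n).log (evidence_pos B _ _).ne').congr_deriv ?_
  have hid := integrable_posterior B (integrable_id_of_memLp_two hB) a (a • x + n)
  have hsq := integrable_posterior B (integrable_norm_sq_of_memLp_id hB) a (a • x + n)
  rw [inner_posteriorMean hB, posteriorSqNorm, ← integral_const_mul,
    ← integral_sub (hid.const_inner _) (hsq.const_mul _), integral_posterior, ← integral_div]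
  exact integral_congr_ae (ae_of_all _ fun u => by simp only [smul_eq_mul]; ring)

variable {B : Measure E} [IsProbabilityMeasure B]

theorem abs_log_evidence_le (hB : MemLp id 2 B) (a : ℝ) (z : E) :
    |Real.log (evidence B a z)| ≤ ‖z‖ ^ 2 / 2 + a ^ 2 * ∫ x, ‖x‖ ^ 2 ∂B := by
  have hpos : 0 ≤ a ^ 2 * ∫ x, ‖x‖ ^ 2 ∂B := by positivity
  have hupper : evidence B a z ≤ Real.exp (‖z‖ ^ 2 / 2) := by
    simpa [evidence] using integral_mono (integrable_exp_logLikelihood B a z)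
      (integrable_const (Real.exp (‖z‖ ^ 2 / 2)))
      fun x => Real.exp_le_exp.2 (logLikelihood_le a z x)
  have hjensen : Real.exp (∫ x, logLikelihood a z x ∂B) ≤ evidence B a z :=
    convexOn_exp.map_integral_le Real.continuous_exp.continuousOn isClosed_univ (by simp)
      (integrable_logLikelihood hB a z) (integrable_exp_logLikelihood B a z)
  rw [← Real.le_log_iff_exp_le (evidence_pos B a z)] at hjensen
  rw [← Real.log_le_iff_le_exp (evidence_pos B a z)] at hupper
  exact abs_le.2 ⟨(neg_le_integral_logLikelihood hB a z).trans hjensen, by linarith⟩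

theorem integral_logLikelihood_le_integral_posterior (hB : MemLp id 2 B) (a : ℝ) (z : E) :
    ∫ x, logLikelihood a z x ∂B ≤ ∫ x, logLikelihood a z x ∂(posterior B a z) := by
  have h := integrable_logLikelihood hB a z
  refine integral_le_integral_tilted h (integrable_exp_logLikelihood B a z) ?_
  exact (integrable_tilted_iff (integrable_exp_logLikelihood B a z) _).1
    (integrable_posterior B h a z)

theorem sq_mul_posteriorSqNorm_le (hB : MemLp id 2 B) (a : ℝ) (z : E) :
    a ^ 2 * posteriorSqNorm B a z ≤ 6 * ‖z‖ ^ 2 + 4 * (a ^ 2 * ∫ x, ‖x‖ ^ 2 ∂B) := by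
  have hsq := ((integrable_posterior B (integrable_norm_sq_of_memLp_id hB) a z).const_mul
    (a ^ 2)).div_const 4
  have hposterior : ∫ x, logLikelihood a z x ∂(posterior B a z) ≤
      ‖z‖ ^ 2 - a ^ 2 * posteriorSqNorm B a z / 4 := by
    have h := integral_mono (integrable_posterior B (integrable_logLikelihood hB a z) a z)
      ((integrable_const _).sub hsq) (logLikelihood_le_sub a z)
    simpa only [posteriorSqNorm, Pi.sub_apply, integral_sub (integrable_const _) hsq,
      integral_const, probReal_univ, one_smul, integral_div, integral_const_mul] using h
  linarith [neg_le_integral_logLikelihood hB a z,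
    integral_logLikelihood_le_integral_posterior hB a z]

end Posterior

section PosteriorMeasurability

variable {E : Type*} [NormedAddCommGroup E] [InnerProductSpace ℝ E] [MeasurableSpace E]
  [BorelSpace E] [SecondCountableTopology E] {S : Type*} [MeasurableSpace S] {a : S → ℝ}
  {z : S → E}

@[fun_prop]
theorem measurable_logLikelihood {x : S → E} (ha : Measurable a) (hz : Measurable z)
    (hx : Measurable x) : Measurable fun s => logLikelihood (a s) (z s) (x s) := by
  unfold logLikelihood; fun_prop

variable (B : Measure E) [SFinite B]

@[fun_prop]
theorem measurable_evidence (ha : Measurable a) (hz : Measurable z) :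
    Measurable fun s => evidence B (a s) (z s) := by
  have h : StronglyMeasurable
      (Function.uncurry fun (s : S) x => Real.exp (logLikelihood (a s) (z s) x)) :=
    (measurable_logLikelihood (ha.comp measurable_fst) (hz.comp measurable_fst)
      measurable_snd).exp.stronglyMeasurable
  exact h.integral_prod_right.measurable

theorem stronglyMeasurable_integral_posterior {F : Type*} [NormedAddCommGroup F]
    [NormedSpace ℝ F] (ha : Measurable a) (hz : Measurable z) {f : S → E → F}
    (hf : StronglyMeasurable f.uncurry) :
    StronglyMeasurable fun s => ∫ x, f s x ∂(posterior B (a s) (z s)) := by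
  have h : StronglyMeasurable (Function.uncurry fun (s : S) x =>
      (Real.exp (logLikelihood (a s) (z s) x) / evidence B (a s) (z s)) • f s x) :=
    (Measurable.div (measurable_logLikelihood (ha.comp measurable_fst) (hz.comp measurable_fst)
      measurable_snd).exp (by fun_prop)).stronglyMeasurable.smul hf
  simp only [integral_posterior]
  exact h.integral_prod_right

@[fun_prop]
theorem measurable_posteriorMean (ha : Measurable a) (hz : Measurable z) :
    Measurable fun s => posteriorMean B (a s) (z s) :=
  (stronglyMeasurable_integral_posterior B ha hz (f := fun _ x => x)
    measurable_snd.stronglyMeasurable).measurable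

@[fun_prop]
theorem measurable_posteriorSqNorm (ha : Measurable a) (hz : Measurable z) :
    Measurable fun s => posteriorSqNorm B (a s) (z s) :=
  (stronglyMeasurable_integral_posterior B ha hz (f := fun _ x => ‖x‖ ^ 2)
    (measurable_snd.norm.pow_const 2).stronglyMeasurable).measurable

end PosteriorMeasurability

section Channel

theorem norm_smul_add_sq_le {E : Type*} [NormedAddCommGroup E] [NormedSpace ℝ E] {a b : ℝ}
    (hab : |a| ≤ b) (x n : E) : ‖a • x + n‖ ^ 2 ≤ 2 * (b ^ 2 * ‖x‖ ^ 2 + ‖n‖ ^ 2) := by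
  have hnorm : ‖a • x + n‖ ≤ b * ‖x‖ + ‖n‖ := by
    refine (norm_add_le _ _).trans ?_
    rw [norm_smul, Real.norm_eq_abs]
    gcongr
  calc ‖a • x + n‖ ^ 2 ≤ (b * ‖x‖ + ‖n‖) ^ 2 := by gcongr
    _ ≤ 2 * ((b * ‖x‖) ^ 2 + ‖n‖ ^ 2) := add_sq_le
    _ = 2 * (b ^ 2 * ‖x‖ ^ 2 + ‖n‖ ^ 2) := by ring

theorem integrable_inner_of_memLp_two {S E : Type*} [MeasurableSpace S] [NormedAddCommGroup E]
    [InnerProductSpace ℝ E] {μ : Measure S} {f g : S → E} (hf : MemLp f 2 μ) (hg : MemLp g 2 μ) :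
    Integrable (fun s => ⟪f s, g s⟫) μ :=
  (hf.norm.integrable_mul hg.norm).mono' (hf.1.inner hg.1)
    (ae_of_all _ fun s => abs_real_inner_le_norm (f s) (g s))

theorem integrable_norm_sq_comp_of_memLp_two {S E : Type*} [MeasurableSpace S]
    [NormedAddCommGroup E] {μ : Measure S} {f : S → E} (hf : MemLp f 2 μ) :
    Integrable (fun s => ‖f s‖ ^ 2) μ :=
  (memLp_two_iff_integrable_sq_norm hf.1).1 hf

variable {E : Type*} [NormedAddCommGroup E] [InnerProductSpace ℝ E] [FiniteDimensional ℝ E]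
  [MeasurableSpace E]

theorem sum_variance_inner {ι : Type*} [Fintype ι] (b : OrthonormalBasis ι ℝ E) {μ : Measure E}
    [IsProbabilityMeasure μ] (hμ : MemLp id 2 μ) :
    ∑ i, Var[(⟪b i, ·⟫); μ] = ∫ x, ‖x‖ ^ 2 ∂μ - ‖∫ x, x ∂μ‖ ^ 2 := by
  have hinner (i : ι) : MemLp (⟪b i, ·⟫) 2 μ := hμ.const_inner (b i)
  simp_rw [fun i => variance_eq_sub (hinner i), Finset.sum_sub_distrib, Pi.pow_apply,
    integral_inner (integrable_id_of_memLp_two hμ), b.sum_sq_inner_right]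
  rw [← integral_finsetSum _ fun i _ => (hinner i).integrable_sq]
  simp_rw [b.sum_sq_inner_right]

/-- The expectation of the logarithm of `evidence B a` at `a • X + N`, where `X ∼ A` and `N` is an
independent standard Gaussian. -/
def expLogEvidence (A B : Measure E) (a : ℝ) : ℝ :=
  ∫ p, Real.log (evidence B a (a • p.1 + p.2)) ∂(A.prod (stdGaussian E))

@[simp]
theorem expLogEvidence_zero (A B : Measure E) [IsProbabilityMeasure B] :
    expLogEvidence A B 0 = 0 := by
  simp [expLogEvidence, evidence, logLikelihood]

variable [BorelSpace E]

section SquareIntegrability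

variable {B : Measure E} [IsProbabilityMeasure B] {S : Type*} [MeasurableSpace S] {μ : Measure S}
  [IsFiniteMeasure μ] {Z : S → E}

theorem integrable_posteriorSqNorm_comp (hB : MemLp id 2 B) {a : ℝ} (ha : a ≠ 0)
    (hZ : MemLp Z 2 μ) : Integrable (fun s => posteriorSqNorm B a (Z s)) μ := by
  refine ((((integrable_norm_sq_comp_of_memLp_two hZ).const_mul 6).add (integrable_const
    (4 * (a ^ 2 * ∫ x, ‖x‖ ^ 2 ∂B)))).div_const (a ^ 2)).mono'
    ((measurable_posteriorSqNorm B measurable_const measurable_id).comp_aemeasurable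
      hZ.1.aemeasurable).aestronglyMeasurable (ae_of_all _ fun s => ?_)
  have hnonneg : 0 ≤ posteriorSqNorm B a (Z s) := integral_nonneg fun x => sq_nonneg _
  rw [Real.norm_of_nonneg hnonneg, le_div_iff₀' (by positivity)]
  exact sq_mul_posteriorSqNorm_le hB a (Z s)

theorem memLp_posteriorMean_comp (hB : MemLp id 2 B) {a : ℝ} (ha : a ≠ 0) (hZ : MemLp Z 2 μ) :
    MemLp (fun s => posteriorMean B a (Z s)) 2 μ := by
  have hmeas : AEStronglyMeasurable (fun s => posteriorMean B a (Z s)) μ :=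
    ((measurable_posteriorMean B measurable_const measurable_id).comp_aemeasurable
      hZ.1.aemeasurable).aestronglyMeasurable
  refine (memLp_two_iff_integrable_sq_norm hmeas).2 <|
    (integrable_posteriorSqNorm_comp hB ha hZ).mono' (hmeas.norm.pow 2) (ae_of_all _ fun s => ?_)
  rw [Real.norm_of_nonneg (sq_nonneg _)]
  exact norm_posteriorMean_sq_le hB a (Z s)

theorem integrable_variance_inner_posterior_comp (hB : MemLp id 2 B) {a : ℝ} (ha : a ≠ 0)
    (hZ : MemLp Z 2 μ) (e : E) :
    Integrable (fun s => Var[(⟪e, ·⟫); posterior B a (Z s)]) μ := by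
  have hinner (z : E) : MemLp (⟪e, ·⟫) 2 (posterior B a z) :=
    (memLp_posterior B hB a z).const_inner e
  have hmeas : Measurable fun z => Var[(⟪e, ·⟫); posterior B a z] := by
    simp_rw [fun z => variance_eq_sub (hinner z)]
    exact (stronglyMeasurable_integral_posterior B measurable_const measurable_id
      (f := fun _ x => ⟪e, x⟫ ^ 2) (by fun_prop)).measurable.sub
      ((stronglyMeasurable_integral_posterior B measurable_const measurable_id
        (f := fun _ x => ⟪e, x⟫) (by fun_prop)).measurable.pow_const 2)
  refine ((integrable_posteriorSqNorm_comp hB ha hZ).const_mul (‖e‖ ^ 2)).mono'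
    (hmeas.comp_aemeasurable hZ.1.aemeasurable).aestronglyMeasurable (ae_of_all _ fun s => ?_)
  rw [Real.norm_of_nonneg (variance_nonneg _ _), posteriorSqNorm, ← integral_const_mul]
  refine (variance_le_expectation_sq (hinner (Z s)).1).trans
    (integral_mono (hinner (Z s)).integrable_sq ((integrable_norm_sq_of_memLp_id
      (memLp_posterior B hB a (Z s))).const_mul _) fun x => ?_)
  simp only [Pi.pow_apply, ← mul_pow]
  exact sq_le_sq.2 ((abs_real_inner_le_norm e x).trans (le_abs_self _))

end SquareIntegrability

section Stein

variable {B : Measure E} [IsProbabilityMeasure B]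

theorem memLp_add_left_stdGaussian (h : E) : MemLp (fun n => h + n) 2 (stdGaussian E) :=
  (memLp_const h).add IsGaussian.memLp_two_id

theorem integral_inner_mul_inner_posteriorMean (hB : MemLp id 2 B) {a : ℝ} (ha : a ≠ 0) (h e : E) :
    ∫ n, ⟪e, n⟫ * ⟪e, posteriorMean B a (h + n)⟫ ∂(stdGaussian E) =
      a * ∫ n, Var[(⟪e, ·⟫); posterior B a (h + n)] ∂(stdGaussian E) := by
  have hmean := (memLp_posteriorMean_comp hB ha (memLp_add_left_stdGaussian h)).const_inner
    (𝕜 := ℝ) e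
  rw [← integral_const_mul]
  refine integral_inner_mul_stdGaussian e (fun n => ?_) (hmean.integrable one_le_two)
    ((integrable_variance_inner_posterior_comp hB ha (memLp_add_left_stdGaussian h) e).const_mul a)
    ((IsGaussian.memLp_two_id.const_inner e).integrable_mul hmean)
  simpa only [HasLineDerivAt, add_assoc] using hasLineDerivAt_inner_posteriorMean hB ha (h + n) e

theorem integral_inner_posteriorMean_stdGaussian (hB : MemLp id 2 B) {a : ℝ} (ha : a ≠ 0) (h : E) :
    ∫ n, ⟪n, posteriorMean B a (h + n)⟫ ∂(stdGaussian E) =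
      a * ∫ n, (posteriorSqNorm B a (h + n) - ‖posteriorMean B a (h + n)‖ ^ 2)
        ∂(stdGaussian E) := by
  set b := stdOrthonormalBasis ℝ E
  have hmean := memLp_posteriorMean_comp hB ha (memLp_add_left_stdGaussian h)
  calc ∫ n, ⟪n, posteriorMean B a (h + n)⟫ ∂(stdGaussian E)
      = ∫ n, ∑ i, ⟪b i, n⟫ * ⟪b i, posteriorMean B a (h + n)⟫ ∂(stdGaussian E) := by
        simp_rw [fun n => (b.sum_inner_mul_inner n (posteriorMean B a (h + n))).symm,
          fun n i => real_inner_comm (b i) n]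
    _ = ∑ i, ∫ n, ⟪b i, n⟫ * ⟪b i, posteriorMean B a (h + n)⟫ ∂(stdGaussian E) :=
        integral_finsetSum _ fun i _ =>
          (IsGaussian.memLp_two_id.const_inner (b i)).integrable_mul (hmean.const_inner (b i))
    _ = a * ∑ i, ∫ n, Var[(⟪b i, ·⟫); posterior B a (h + n)] ∂(stdGaussian E) := by
        simp_rw [integral_inner_mul_inner_posteriorMean hB ha, Finset.mul_sum]
    _ = a * ∫ n, ∑ i, Var[(⟪b i, ·⟫); posterior B a (h + n)] ∂(stdGaussian E) := by
        rw [integral_finsetSum _ fun i _ => integrable_variance_inner_posterior_comp hB ha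
          (memLp_add_left_stdGaussian h) (b i)]
    _ = _ := by
        simp_rw [fun z => sum_variance_inner b (memLp_posterior B hB a z)]
        rfl

end Stein

section ExpLogEvidence

variable {A B : Measure E}

theorem integrable_norm_sq_fst (hA : MemLp id 2 A) :
    Integrable (fun p : E × E => ‖p.1‖ ^ 2) (A.prod (stdGaussian E)) :=
  (integrable_norm_sq_of_memLp_id hA).comp_fst _

variable [IsProbabilityMeasure A] [IsProbabilityMeasure B]

theorem memLp_path (hA : MemLp id 2 A) (a : ℝ) :
    MemLp (fun p : E × E => a • p.1 + p.2) 2 (A.prod (stdGaussian E)) :=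
  ((hA.comp_fst _).const_smul a).add (IsGaussian.memLp_two_id.comp_snd A)

theorem memLp_posteriorMean_path (hA : MemLp id 2 A) (hB : MemLp id 2 B) {a : ℝ} (ha : a ≠ 0) :
    MemLp (fun p : E × E => posteriorMean B a (a • p.1 + p.2)) 2 (A.prod (stdGaussian E)) :=
  memLp_posteriorMean_comp hB ha (memLp_path hA a)

theorem integrable_norm_sq_snd :
    Integrable (fun p : E × E => ‖p.2‖ ^ 2) (A.prod (stdGaussian E)) :=
  (integrable_norm_sq_of_memLp_id IsGaussian.memLp_two_id).comp_snd A

theorem integrable_log_evidence_path (hA : MemLp id 2 A) (hB : MemLp id 2 B) (a : ℝ) :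
    Integrable (fun p : E × E => Real.log (evidence B a (a • p.1 + p.2)))
      (A.prod (stdGaussian E)) :=
  (((integrable_norm_sq_comp_of_memLp_two (memLp_path hA a)).div_const 2).add
    (integrable_const _)).mono' (Measurable.aestronglyMeasurable (by fun_prop))
    (ae_of_all _ fun _ => abs_log_evidence_le hB a _)

theorem continuous_expLogEvidence (hA : MemLp id 2 A) (hB : MemLp id 2 B) :
    Continuous (expLogEvidence A B) := by
  refine continuous_iff_continuousAt.2 fun a => ?_
  set c := |a| + 1
  refine continuousAt_of_dominated
    (bound := fun p : E × E => c ^ 2 * ‖p.1‖ ^ 2 + ‖p.2‖ ^ 2 + c ^ 2 * ∫ x, ‖x‖ ^ 2 ∂B)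
    (.of_forall fun s => Measurable.aestronglyMeasurable (by fun_prop)) ?_
    ((((integrable_norm_sq_fst hA).const_mul _).add integrable_norm_sq_snd).add
      (integrable_const _))
    (ae_of_all _ fun p => (hasDerivAt_log_evidence_path hB a p.1 p.2).continuousAt)
  filter_upwards [Metric.ball_mem_nhds a one_pos] with s hs
  have hsc : |s| ≤ c := by
    have hdist : |s - a| < 1 := hs
    linarith [abs_sub_abs_le_abs_sub s a]
  refine ae_of_all _ fun p => (abs_log_evidence_le hB s _).trans (add_le_add ?_ ?_)
  · linarith [norm_smul_add_sq_le hsc p.1 p.2]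
  · rw [← sq_abs s]
    gcongr

theorem abs_log_evidence_path_deriv_le (hB : MemLp id 2 B) {a s : ℝ} (ha : 0 < a)
    (hs : s ∈ Set.Icc (a / 2) (2 * a)) (x n : E) :
    |⟪n + (2 * s) • x, posteriorMean B s (s • x + n)⟫ - s * posteriorSqNorm B s (s • x + n)| ≤
      (4 * a) ^ 2 * ‖x‖ ^ 2 + ‖n‖ ^ 2 + (1 / 2 + 2 * a) *
        (48 / a ^ 2 * ((2 * a) ^ 2 * ‖x‖ ^ 2 + ‖n‖ ^ 2) + 4 * ∫ x, ‖x‖ ^ 2 ∂B) := by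
  obtain ⟨hs1, hs2⟩ := hs
  have hs0 : 0 < s := by linarith
  set z := s • x + n
  have hsq0 : 0 ≤ posteriorSqNorm B s z := integral_nonneg fun x => sq_nonneg _
  have hsq : posteriorSqNorm B s z ≤
      48 / a ^ 2 * ((2 * a) ^ 2 * ‖x‖ ^ 2 + ‖n‖ ^ 2) + 4 * ∫ x, ‖x‖ ^ 2 ∂B := by
    have hz : ‖z‖ ^ 2 ≤ 2 * ((2 * a) ^ 2 * ‖x‖ ^ 2 + ‖n‖ ^ 2) :=
      norm_smul_add_sq_le (by rwa [abs_of_pos hs0]) x n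
    have hscale : a ^ 2 ≤ 4 * s ^ 2 := by nlinarith
    have hratio : 1 ≤ 4 * s ^ 2 / a ^ 2 := (one_le_div (by positivity)).2 hscale
    have hK := le_mul_of_one_le_left
      (by positivity : 0 ≤ (2 * a) ^ 2 * ‖x‖ ^ 2 + ‖n‖ ^ 2) hratio
    refine le_of_mul_le_mul_left ?_ (by positivity : 0 < s ^ 2)
    calc s ^ 2 * posteriorSqNorm B s z
        ≤ 12 * (4 * s ^ 2 / a ^ 2 * ((2 * a) ^ 2 * ‖x‖ ^ 2 + ‖n‖ ^ 2)) +
            4 * (s ^ 2 * ∫ x, ‖x‖ ^ 2 ∂B) := by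
          linarith [sq_mul_posteriorSqNorm_le hB s z]
      _ = s ^ 2 * (48 / a ^ 2 * ((2 * a) ^ 2 * ‖x‖ ^ 2 + ‖n‖ ^ 2) + 4 * ∫ x, ‖x‖ ^ 2 ∂B) := by
          ring
  have hinner : |⟪n + (2 * s) • x, posteriorMean B s z⟫| ≤
      (4 * a) ^ 2 * ‖x‖ ^ 2 + ‖n‖ ^ 2 + posteriorSqNorm B s z / 2 := by
    have hpath := norm_smul_add_sq_le (a := 2 * s) (b := 4 * a)
      (by rw [abs_of_pos (by positivity)]; linarith) x n
    rw [add_comm] at hpath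
    have hamgm := two_mul_le_add_sq ‖n + (2 * s) • x‖ ‖posteriorMean B s z‖
    linarith [abs_real_inner_le_norm (n + (2 * s) • x) (posteriorMean B s z),
      norm_posteriorMean_sq_le hB s z]
  have hmul : s * posteriorSqNorm B s z ≤ 2 * a * posteriorSqNorm B s z := by gcongr
  calc |⟪n + (2 * s) • x, posteriorMean B s z⟫ - s * posteriorSqNorm B s z|
      ≤ |⟪n + (2 * s) • x, posteriorMean B s z⟫| + s * posteriorSqNorm B s z := by
        refine (abs_sub _ _).trans_eq ?_
        rw [abs_of_nonneg (mul_nonneg hs0.le hsq0)]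
    _ ≤ (4 * a) ^ 2 * ‖x‖ ^ 2 + ‖n‖ ^ 2 + (1 / 2 + 2 * a) * posteriorSqNorm B s z := by
        linarith
    _ ≤ _ := by gcongr

theorem hasDerivAt_expLogEvidence_path (hA : MemLp id 2 A) (hB : MemLp id 2 B) {a : ℝ}
    (ha : 0 < a) :
    HasDerivAt (expLogEvidence A B)
      (∫ p, (⟪p.2 + (2 * a) • p.1, posteriorMean B a (a • p.1 + p.2)⟫ -
        a * posteriorSqNorm B a (a • p.1 + p.2)) ∂(A.prod (stdGaussian E))) a := by
  have hfst := integrable_norm_sq_fst hA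
  have hsnd := integrable_norm_sq_snd (A := A)
  exact (hasDerivAt_integral_of_dominated_loc_of_deriv_le
    (Icc_mem_nhds (by linarith : a / 2 < a) (by linarith : a < 2 * a))
    (.of_forall fun s => Measurable.aestronglyMeasurable (by fun_prop))
    (integrable_log_evidence_path hA hB a) (Measurable.aestronglyMeasurable (by fun_prop))
    (ae_of_all _ fun p s hs => abs_log_evidence_path_deriv_le hB ha hs p.1 p.2)
    (((hfst.const_mul _).add hsnd).add (((((hfst.const_mul _).add hsnd).const_mul _).add
      (integrable_const _)).const_mul _))
    (ae_of_all _ fun p s _ => hasDerivAt_log_evidence_path hB s p.1 p.2)).2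

theorem integral_inner_snd_posteriorMean_path (hA : MemLp id 2 A) (hB : MemLp id 2 B) {a : ℝ}
    (ha : a ≠ 0) :
    ∫ p : E × E, ⟪p.2, posteriorMean B a (a • p.1 + p.2)⟫ ∂(A.prod (stdGaussian E)) =
      a * ∫ p : E × E, (posteriorSqNorm B a (a • p.1 + p.2) -
        ‖posteriorMean B a (a • p.1 + p.2)‖ ^ 2) ∂(A.prod (stdGaussian E)) := by
  have hmean := memLp_posteriorMean_path hA hB ha
  have hinner := integrable_inner_of_memLp_two (IsGaussian.memLp_two_id.comp_snd A) hmean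
  have hgap := (integrable_posteriorSqNorm_comp hB ha (memLp_path hA a)).sub
    (integrable_norm_sq_comp_of_memLp_two hmean)
  refine (integral_prod _ hinner).trans (Eq.trans ?_ (congrArg (a * ·) (integral_prod _ hgap).symm))
  rw [← integral_const_mul]
  exact integral_congr_ae (ae_of_all _ fun x =>
    integral_inner_posteriorMean_stdGaussian hB ha (a • x))

theorem hasDerivAt_expLogEvidence (hA : MemLp id 2 A) (hB : MemLp id 2 B) {a : ℝ} (ha : 0 < a) :
    HasDerivAt (expLogEvidence A B)
      (a * ∫ p, (2 * ⟪p.1, posteriorMean B a (a • p.1 + p.2)⟫ -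
        ‖posteriorMean B a (a • p.1 + p.2)‖ ^ 2) ∂(A.prod (stdGaussian E))) a := by
  refine (hasDerivAt_expLogEvidence_path hA hB ha).congr_deriv ?_
  have hmean := memLp_posteriorMean_path hA hB ha.ne'
  have hfst := integrable_inner_of_memLp_two (hA.comp_fst (stdGaussian E)) hmean
  have hsnd := integrable_inner_of_memLp_two (IsGaussian.memLp_two_id.comp_snd A) hmean
  have hmeansq := integrable_norm_sq_comp_of_memLp_two hmean
  have hsq := integrable_posteriorSqNorm_comp hB ha.ne' (memLp_path hA a)
  have hstein := integral_inner_snd_posteriorMean_path hA hB ha.ne'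
  simp only [id] at hfst hsnd
  simp_rw [inner_add_left, real_inner_smul_left, add_sub_assoc]
  rw [integral_add hsnd ((hfst.const_mul _).sub' (hsq.const_mul a)),
    integral_sub (hfst.const_mul _) (hsq.const_mul a), hstein, integral_sub hsq hmeansq,
    integral_sub (hfst.const_mul 2) hmeansq]
  simp only [integral_const_mul]
  ring

end ExpLogEvidence

section GaussianChannel

/-- The law of the output `a • X + N` of a channel with signal strength `a`, input `X ∼ A` and
independent standard Gaussian noise `N`. -/
def gaussianChannel (A : Measure E) (a : ℝ) : Measure E :=
  (A.prod (stdGaussian E)).map fun p => a • p.1 + p.2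

theorem map_path_prod_stdGaussian (A : Measure E) [SFinite A] (a : ℝ) :
    (A.prod (stdGaussian E)).map (fun p => (p.1, a • p.1 + p.2)) =
      (A.prod (stdGaussian E)).withDensity
        fun p => ENNReal.ofReal (Real.exp (logLikelihood a p.2 p.1)) := by
  refine Measure.ext_of_lintegral _ fun f hf => ?_
  rw [lintegral_map hf (by fun_prop),
    lintegral_withDensity_eq_lintegral_mul _ (by fun_prop) hf,
    lintegral_prod _ (by fun_prop), lintegral_prod _ (by fun_prop)]
  refine lintegral_congr fun x => ?_
  rw [lintegral_add_left_stdGaussian (a • x) (f := fun z => f (x, z)) (by fun_prop)]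
  refine lintegral_congr fun z => ?_
  simp only [Pi.mul_apply, logLikelihood, real_inner_smul_left, norm_smul, mul_pow,
    Real.norm_eq_abs, sq_abs, real_inner_comm x z]

theorem gaussianChannel_eq_withDensity (A : Measure E) [IsFiniteMeasure A] (a : ℝ) :
    gaussianChannel A a =
      (stdGaussian E).withDensity fun z => ENNReal.ofReal (evidence A a z) := by
  refine Measure.ext_of_lintegral _ fun f hf => ?_
  have hmap : gaussianChannel A a =
      ((A.prod (stdGaussian E)).map fun p => (p.1, a • p.1 + p.2)).map Prod.snd := by
    rw [Measure.map_map measurable_snd (by fun_prop)]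
    rfl
  rw [hmap, map_path_prod_stdGaussian, lintegral_map hf measurable_snd,
    lintegral_withDensity_eq_lintegral_mul _ (by fun_prop) (by fun_prop),
    lintegral_withDensity_eq_lintegral_mul _ (by fun_prop) hf,
    lintegral_prod_symm _ (by fun_prop)]
  refine lintegral_congr fun z => ?_
  simp only [Pi.mul_apply]
  rw [lintegral_mul_const _ (by fun_prop), evidence, ofReal_integral_eq_lintegral_ofReal
    (integrable_exp_logLikelihood A a z) (ae_of_all _ fun x => (Real.exp_pos _).le)]

theorem integral_integral_posterior {F : Type*} [NormedAddCommGroup F] [NormedSpace ℝ F]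
    (A : Measure E) [IsProbabilityMeasure A] (a : ℝ) {f : E × E → F} (hf : StronglyMeasurable f)
    (hint : Integrable (fun p : E × E => f (p.1, a • p.1 + p.2)) (A.prod (stdGaussian E))) :
    ∫ z, ∫ x, f (x, z) ∂(posterior A a z) ∂(gaussianChannel A a) =
      ∫ p, f (p.1, a • p.1 + p.2) ∂(A.prod (stdGaussian E)) := by
  have hpath : Measurable fun p : E × E => (p.1, a • p.1 + p.2) := by fun_prop
  have hexp : Measurable fun p : E × E => Real.toNNReal (Real.exp (logLikelihood a p.2 p.1)) := by
    fun_prop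
  have hev : Measurable fun z => Real.toNNReal (evidence A a z) := by fun_prop
  have hjoint := map_path_prod_stdGaussian A a
  have hmapped := (integrable_map_measure hf.aestronglyMeasurable hpath.aemeasurable).2 hint
  rw [hjoint] at hmapped
  have hsmul := (integrable_withDensity_iff_integrable_smul hexp).1 hmapped
  rw [← integral_map hpath.aemeasurable hf.aestronglyMeasurable, hjoint,
    gaussianChannel_eq_withDensity]
  refine (integral_withDensity_eq_integral_smul hev _).trans
    (Eq.trans ?_ (integral_withDensity_eq_integral_smul hexp _).symm)
  rw [integral_prod_symm _ hsmul]
  refine integral_congr_ae (ae_of_all _ fun z => ?_)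
  simp only [integral_posterior, NNReal.smul_def, Real.coe_toNNReal _ (evidence_pos A a z).le,
    Real.coe_toNNReal _ (Real.exp_pos _).le]
  rw [← integral_smul]
  simp_rw [smul_smul, mul_div_cancel₀ _ (evidence_pos A a z).ne']

instance isProbabilityMeasure_gaussianChannel (A : Measure E) [IsProbabilityMeasure A] (a : ℝ) :
    IsProbabilityMeasure (gaussianChannel A a) :=
  Measure.isProbabilityMeasure_map (by fun_prop)

theorem klDiv_withDensity_ofReal {S : Type*} [MeasurableSpace S] {ν : Measure S}
    [IsProbabilityMeasure ν] {r : S → ℝ} (hr : Measurable r) (hr0 : ∀ x, 0 ≤ r x)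
    [IsProbabilityMeasure (ν.withDensity fun x => ENNReal.ofReal (r x))]
    (hint : Integrable (fun x => Real.log (r x)) (ν.withDensity fun x => ENNReal.ofReal (r x))) :
    klDiv (ν.withDensity fun x => ENNReal.ofReal (r x)) ν =
      ENNReal.ofReal (∫ x, Real.log (r x) ∂(ν.withDensity fun x => ENNReal.ofReal (r x))) := by
  have hac := withDensity_absolutelyContinuous ν fun x => ENNReal.ofReal (r x)
  have hllr : llr (ν.withDensity fun x => ENNReal.ofReal (r x)) ν
      =ᵐ[ν.withDensity fun x => ENNReal.ofReal (r x)] fun x => Real.log (r x) := by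
    filter_upwards [hac.ae_le (Measure.rnDeriv_withDensity ν hr.ennreal_ofReal)] with x hx
    rw [llr, hx, ENNReal.toReal_ofReal (hr0 x)]
  rw [klDiv_of_ac_of_integrable hac (hint.congr hllr.symm), integral_congr_ae hllr]
  simp

variable {A B : Measure E} [IsProbabilityMeasure A] [IsProbabilityMeasure B]

theorem gaussianChannel_eq_withDensity_gaussianChannel (a : ℝ) :
    gaussianChannel A a = (gaussianChannel B a).withDensity
      fun z => ENNReal.ofReal (evidence A a z / evidence B a z) := by
  rw [gaussianChannel_eq_withDensity A, gaussianChannel_eq_withDensity B,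
    ← withDensity_mul _ (by fun_prop) (by fun_prop)]
  congr with z
  rw [Pi.mul_apply, ← ENNReal.ofReal_mul (evidence_pos B a z).le,
    mul_div_cancel₀ _ (evidence_pos B a z).ne']

theorem klDiv_gaussianChannel (hA : MemLp id 2 A) (hB : MemLp id 2 B) (a : ℝ) :
    klDiv (gaussianChannel A a) (gaussianChannel B a) =
      ENNReal.ofReal (expLogEvidence A A a - expLogEvidence A B a) := by
  have hdensity := gaussianChannel_eq_withDensity_gaussianChannel (A := A) (B := B) a
  have hpath : Measurable fun p : E × E => a • p.1 + p.2 := by fun_prop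
  have hlog (z : E) : Real.log (evidence A a z / evidence B a z) =
      Real.log (evidence A a z) - Real.log (evidence B a z) :=
    Real.log_div (evidence_pos A a z).ne' (evidence_pos B a z).ne'
  have hmeas : Measurable fun z => Real.log (evidence A a z / evidence B a z) := by fun_prop
  have hpathlog := (integrable_log_evidence_path hA hA a).sub'
    (integrable_log_evidence_path hA hB a)
  have hint : Integrable (fun z => Real.log (evidence A a z / evidence B a z))
      (gaussianChannel A a) := by
    refine (integrable_map_measure hmeas.aestronglyMeasurable hpath.aemeasurable).2 ?_
    simpa only [Function.comp_def, hlog] using hpathlog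
  have hval : ∫ z, Real.log (evidence A a z / evidence B a z) ∂(gaussianChannel A a) =
      expLogEvidence A A a - expLogEvidence A B a := by
    rw [gaussianChannel, integral_map hpath.aemeasurable hmeas.aestronglyMeasurable]
    simp_rw [hlog]
    exact integral_sub (integrable_log_evidence_path hA hA a) (integrable_log_evidence_path hA hB a)
  have hprob := isProbabilityMeasure_gaussianChannel A a
  rw [← hval]
  rw [hdensity] at hint hprob ⊢
  exact klDiv_withDensity_ofReal (by fun_prop)
    (fun z => div_nonneg (evidence_pos A a z).le (evidence_pos B a z).le) hint

theorem integral_inner_fst_eq_integral_inner_posteriorMean (hA : MemLp id 2 A) {a : ℝ}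
    (ha : a ≠ 0) {φ : E → E} (hφ : Measurable φ)
    (hφ2 : MemLp (fun p : E × E => φ (a • p.1 + p.2)) 2 (A.prod (stdGaussian E))) :
    ∫ p : E × E, ⟪p.1, φ (a • p.1 + p.2)⟫ ∂(A.prod (stdGaussian E)) =
      ∫ p : E × E, ⟪posteriorMean A a (a • p.1 + p.2), φ (a • p.1 + p.2)⟫
        ∂(A.prod (stdGaussian E)) := by
  rw [← integral_integral_posterior A a (f := fun p => ⟪p.1, φ p.2⟫) (by fun_prop)
    (integrable_inner_of_memLp_two (hA.comp_fst _) hφ2),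
    ← integral_integral_posterior A a (f := fun p => ⟪posteriorMean A a p.2, φ p.2⟫)
    (Measurable.stronglyMeasurable (by fun_prop))
    (integrable_inner_of_memLp_two (memLp_posteriorMean_path hA hA ha) hφ2)]
  simp_rw [real_inner_comm (φ _), ← inner_posteriorMean hA]
  simp

theorem hasDerivAt_expLogEvidence_sub (hA : MemLp id 2 A) (hB : MemLp id 2 B) {a : ℝ}
    (ha : 0 < a) :
    HasDerivAt (fun a => expLogEvidence A A a - expLogEvidence A B a)
      (a * ∫ z, ‖posteriorMean A a z - posteriorMean B a z‖ ^ 2 ∂(gaussianChannel A a)) a := by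
  refine ((hasDerivAt_expLogEvidence hA hA ha).sub
    (hasDerivAt_expLogEvidence hA hB ha)).congr_deriv ?_
  have hmeanA := memLp_posteriorMean_path hA hA ha.ne'
  have hmeanB := memLp_posteriorMean_path hA hB ha.ne'
  have hsqA := integrable_norm_sq_comp_of_memLp_two hmeanA
  have hsqB := integrable_norm_sq_comp_of_memLp_two hmeanB
  have hinner {g : E × E → E} (hg : MemLp g 2 (A.prod (stdGaussian E))) :=
    integrable_inner_of_memLp_two hmeanA hg
  have hfst {g : E × E → E} (hg : MemLp g 2 (A.prod (stdGaussian E))) :=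
    integrable_inner_of_memLp_two (hA.comp_fst (stdGaussian E)) hg
  simp only [id] at hfst
  rw [← mul_sub, gaussianChannel, integral_map (by fun_prop)
    (Measurable.aestronglyMeasurable (by fun_prop)),
    integral_sub ((hfst hmeanA).const_mul 2) hsqA, integral_sub ((hfst hmeanB).const_mul 2) hsqB]
  simp_rw [integral_const_mul]
  rw [integral_inner_fst_eq_integral_inner_posteriorMean hA ha.ne' (by fun_prop) hmeanA,
    integral_inner_fst_eq_integral_inner_posteriorMean hA ha.ne' (by fun_prop) hmeanB]
  simp_rw [norm_sub_sq_real, real_inner_self_eq_norm_sq]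
  rw [integral_add (hsqA.sub' ((hinner hmeanB).const_mul 2)) hsqB,
    integral_sub hsqA ((hinner hmeanB).const_mul 2), integral_const_mul]
  ring

end GaussianChannel

end Channel

section Flow

variable {d : ℕ}

section Formulas

variable {t : ℝ}

theorem linearFlow_eq_smul (ht : t ≠ 1) (x₁ x : EuclideanSpace ℝ (Fin d)) :
    linearFlow t x₁ x = (1 - t) • ((t / (1 - t)) • x₁ + x) := by
  rw [linearFlow, smul_add, smul_smul, mul_div_cancel₀ _ (sub_ne_zero.2 ht.symm)]

theorem condPathDensity_eq (t : ℝ) (x₁ x : EuclideanSpace ℝ (Fin d)) :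
    condPathDensity t x₁ x =
      ((√(2 * Real.pi) * (1 - t)) ^ d)⁻¹ * Real.exp (-‖(1 - t)⁻¹ • x‖ ^ 2 / 2) *
        Real.exp (logLikelihood (t / (1 - t)) ((1 - t)⁻¹ • x) x₁) := by
  have hrescale : (1 - t)⁻¹ • x - (t / (1 - t)) • x₁ = (1 - t)⁻¹ • (x - t • x₁) := by
    rw [smul_sub, smul_smul, div_eq_inv_mul]
  rw [condPathDensity, logLikelihood_eq, hrescale, mul_assoc, ← Real.exp_add]
  congr 2
  simp only [norm_smul, mul_pow, norm_inv, inv_pow, Real.norm_eq_abs, sq_abs]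
  field_simp
  ring

theorem condPathDensity_div_pathDensity (A : Measure (EuclideanSpace ℝ (Fin d))) (ht : t ≠ 1)
    (x₁ x : EuclideanSpace ℝ (Fin d)) :
    condPathDensity t x₁ x / pathDensity A t x =
      Real.exp (logLikelihood (t / (1 - t)) ((1 - t)⁻¹ • x) x₁) /
        evidence A (t / (1 - t)) ((1 - t)⁻¹ • x) := by
  simp only [pathDensity, condPathDensity_eq, integral_const_mul]
  have := sub_ne_zero.2 ht.symm
  exact mul_div_mul_left _ _ (by positivity)

theorem velocity_eq {A : Measure (EuclideanSpace ℝ (Fin d))} [IsProbabilityMeasure A]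
    (hA : MemLp id 2 A) (ht : t ≠ 1) (x : EuclideanSpace ℝ (Fin d)) :
    velocity A t x =
      (1 - t)⁻¹ • (posteriorMean A (t / (1 - t)) ((1 - t)⁻¹ • x) - x) := by
  have hid := integrable_posterior A (integrable_id_of_memLp_two hA) (t / (1 - t)) ((1 - t)⁻¹ • x)
  simp only [velocity, condPathDensity_div_pathDensity A ht]
  rw [← integral_posterior]
  simp only [condVelocity]
  rw [integral_smul, integral_sub hid (integrable_const x), integral_const, probReal_univ, one_smul,
    posteriorMean]

end Formulas

section Measurability

variable {S : Type*} [MeasurableSpace S] {t : S → ℝ} {x₁ x : S → EuclideanSpace ℝ (Fin d)}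

@[fun_prop]
theorem measurable_linearFlow (ht : Measurable t) (hx₁ : Measurable x₁) (hx : Measurable x) :
    Measurable fun s => linearFlow (t s) (x₁ s) (x s) := by
  unfold linearFlow
  fun_prop

@[fun_prop]
theorem measurable_condPathDensity (ht : Measurable t) (hx₁ : Measurable x₁) (hx : Measurable x) :
    Measurable fun s => condPathDensity (t s) (x₁ s) (x s) := by
  unfold condPathDensity
  fun_prop

@[fun_prop]
theorem measurable_condVelocity (ht : Measurable t) (hx₁ : Measurable x₁) (hx : Measurable x) :
    Measurable fun s => condVelocity (t s) (x₁ s) (x s) := by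
  unfold condVelocity
  fun_prop

variable (A : Measure (EuclideanSpace ℝ (Fin d))) [SFinite A]

@[fun_prop]
theorem measurable_pathDensity (ht : Measurable t) (hx : Measurable x) :
    Measurable fun s => pathDensity A (t s) (x s) := by
  have hcond : Measurable fun q : S × EuclideanSpace ℝ (Fin d) =>
      condPathDensity (t q.1) q.2 (x q.1) := by fun_prop
  exact (hcond.stronglyMeasurable.integral_prod_right' (ν := A)).measurable

@[fun_prop]
theorem measurable_velocity (ht : Measurable t) (hx : Measurable x) :
    Measurable fun s => velocity A (t s) (x s) := by
  have hintegrand : Measurable fun q : S × EuclideanSpace ℝ (Fin d) =>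
      (condPathDensity (t q.1) q.2 (x q.1) / pathDensity A (t q.1) (x q.1)) •
        condVelocity (t q.1) q.2 (x q.1) := by fun_prop
  exact (hintegrand.stronglyMeasurable.integral_prod_right' (ν := A)).measurable

end Measurability

variable {A B : Measure (EuclideanSpace ℝ (Fin d))}

theorem integral_probPath (A : Measure (EuclideanSpace ℝ (Fin d))) (t : ℝ)
    {f : EuclideanSpace ℝ (Fin d) → ℝ} (hf : Measurable f) :
    ∫ x, f x ∂(probPath A t) =
      ∫ p, f (linearFlow t p.1 p.2) ∂(A.prod (stdGaussian (EuclideanSpace ℝ (Fin d)))) :=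
  integral_map (Measurable.aemeasurable (by fun_prop)) hf.aestronglyMeasurable

section Path

variable [IsProbabilityMeasure A] [IsProbabilityMeasure B]

theorem klDiv_probPath_le (t : ℝ) : klDiv (probPath A t) (probPath B t) ≤ klDiv A B := by
  refine (klDiv_map_le _ _ (by fun_prop)).trans_eq ?_
  rw [← Measure.compProd_const, ← Measure.compProd_const, klDiv_compProd_left]

instance isProbabilityMeasure_probPath (t : ℝ) : IsProbabilityMeasure (probPath A t) :=
  Measure.isProbabilityMeasure_map (Measurable.aemeasurable (by fun_prop))

theorem tendsto_probPath (A : Measure (EuclideanSpace ℝ (Fin d))) [IsProbabilityMeasure A] :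
    Tendsto (β := FiniteMeasure (EuclideanSpace ℝ (Fin d)))
      (fun t => ⟨probPath A t, inferInstance⟩) (𝓝 1) (𝓝 ⟨A, inferInstance⟩) := by
  refine FiniteMeasure.tendsto_iff_forall_integral_tendsto.2 fun f => ?_
  simp only [FiniteMeasure.toMeasure_mk, integral_probPath A _ f.continuous.measurable]
  have hlimit : ∫ x, f x ∂A = ∫ p, f (linearFlow 1 p.1 p.2)
      ∂(A.prod (stdGaussian (EuclideanSpace ℝ (Fin d)))) := by
    simp [linearFlow, integral_fun_fst]
  have hf := f.continuous
  have hcont : Continuous fun t : ℝ => ∫ p, f (linearFlow t p.1 p.2)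
      ∂(A.prod (stdGaussian (EuclideanSpace ℝ (Fin d)))) := by
    unfold linearFlow
    exact continuous_of_dominated (fun t => Continuous.aestronglyMeasurable (by fun_prop))
      (fun t => ae_of_all _ fun p => f.norm_coe_le_norm _) (integrable_const ‖f‖)
      (ae_of_all _ fun p => by fun_prop)
  rw [hlimit]
  exact hcont.tendsto 1

theorem tendsto_klDiv_probPath :
    Tendsto (fun t => klDiv (probPath A t) (probPath B t)) (𝓝 1) (𝓝 (klDiv A B)) :=
  tendsto_order.2
    ⟨fun c hc => ((tendsto_probPath A).prodMk_nhds (tendsto_probPath B)).eventually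
      (lowerSemicontinuous_klDiv _ c hc),
    fun _ hc => Eventually.of_forall fun t => (klDiv_probPath_le t).trans_lt hc⟩

theorem probPath_eq_map_gaussianChannel (A : Measure (EuclideanSpace ℝ (Fin d))) {t : ℝ}
    (ht : t ≠ 1) : probPath A t = (gaussianChannel A (t / (1 - t))).map ((1 - t) • ·) := by
  rw [gaussianChannel, Measure.map_map (by fun_prop) (by fun_prop), probPath]
  simp only [linearFlow_eq_smul ht, Function.comp_def]

theorem klDiv_probPath (hA : MemLp id 2 A) (hB : MemLp id 2 B) {t : ℝ} (ht : t ≠ 1) :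
    klDiv (probPath A t) (probPath B t) =
      ENNReal.ofReal (expLogEvidence A A (t / (1 - t)) - expLogEvidence A B (t / (1 - t))) := by
  rw [← klDiv_gaussianChannel hA hB, probPath_eq_map_gaussianChannel A ht,
    probPath_eq_map_gaussianChannel B ht]
  exact klDiv_map_measurableEquiv _ _ (MeasurableEquiv.smul₀ (1 - t) (sub_ne_zero.2 ht.symm))

end Path

section Derivative

variable [IsProbabilityMeasure A] [IsProbabilityMeasure B]

/-- `E_{X_t ∼ p_t^A} [t / (1 - t) * ‖u_t^A(X_t) - u_t^B(X_t)‖²]`, the rate at which the divergence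
of the probability paths with target laws `A` and `B` grows. -/
def velocitySqGap (A B : Measure (EuclideanSpace ℝ (Fin d))) (t : ℝ) : ℝ :=
  t / (1 - t) * ∫ x, ‖velocity A t x - velocity B t x‖ ^ 2 ∂(probPath A t)

theorem velocitySqGap_nonneg (A B : Measure (EuclideanSpace ℝ (Fin d))) {t : ℝ} (h0 : 0 ≤ t)
    (h1 : t < 1) : 0 ≤ velocitySqGap A B t :=
  mul_nonneg (div_nonneg h0 (sub_pos.2 h1).le) (integral_nonneg fun _ => sq_nonneg _)

theorem velocitySqGap_eq (hA : MemLp id 2 A) (hB : MemLp id 2 B) {t : ℝ} (ht : t ≠ 1) :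
    velocitySqGap A B t = t / (1 - t) * ((1 - t)⁻¹ ^ 2 *
      ∫ z, ‖posteriorMean A (t / (1 - t)) z - posteriorMean B (t / (1 - t)) z‖ ^ 2
        ∂(gaussianChannel A (t / (1 - t)))) := by
  rw [velocitySqGap, probPath_eq_map_gaussianChannel A ht, integral_map (by fun_prop)]
  · simp only [velocity_eq hA ht, velocity_eq hB ht, ← smul_sub, sub_sub_sub_cancel_right,
      norm_smul, mul_pow, Real.norm_eq_abs, sq_abs, integral_const_mul,
      inv_smul_smul₀ (sub_ne_zero.2 ht.symm)]
  · exact Measurable.aestronglyMeasurable (by fun_prop)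

theorem hasDerivAt_div_one_sub {t : ℝ} (ht : t ≠ 1) :
    HasDerivAt (fun t : ℝ => t / (1 - t)) ((1 - t)⁻¹ ^ 2) t := by
  have hs : 1 - t ≠ 0 := sub_ne_zero.2 ht.symm
  refine ((hasDerivAt_id t).fun_div ((hasDerivAt_id t).const_sub 1) hs).congr_deriv ?_
  simp only [id]
  field_simp
  ring

theorem hasDerivAt_expLogEvidence_sub_time (hA : MemLp id 2 A) (hB : MemLp id 2 B) {t : ℝ}
    (h0 : 0 < t) (h1 : t < 1) :
    HasDerivAt (fun t => expLogEvidence A A (t / (1 - t)) - expLogEvidence A B (t / (1 - t)))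
      (velocitySqGap A B t) t := by
  refine ((hasDerivAt_expLogEvidence_sub hA hB (div_pos h0 (sub_pos.2 h1))).comp t
    (hasDerivAt_div_one_sub h1.ne)).congr_deriv ?_
  rw [velocitySqGap_eq hA hB h1.ne]
  ring

theorem klDiv_probPath_eq_lintegral_velocitySqGap (hA : MemLp id 2 A) (hB : MemLp id 2 B) {b : ℝ}
    (h0 : 0 ≤ b) (h1 : b < 1) :
    klDiv (probPath A b) (probPath B b) =
      ∫⁻ t in Set.Ioo 0 b, ENNReal.ofReal (velocitySqGap A B t) := by
  have hcont : ContinuousOn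
      (fun t => expLogEvidence A A (t / (1 - t)) - expLogEvidence A B (t / (1 - t)))
      (Set.Icc 0 b) :=
    ((continuous_expLogEvidence hA hA).sub (continuous_expLogEvidence hA hB)).comp_continuousOn
      fun t ht => (hasDerivAt_div_one_sub (ht.2.trans_lt h1).ne).continuousAt.continuousWithinAt
  have hderiv (t) (ht : t ∈ Set.Ioo 0 b) :=
    hasDerivAt_expLogEvidence_sub_time hA hB ht.1 (ht.2.trans h1)
  have hnonneg (t) (ht : t ∈ Set.Ioo 0 b) : 0 ≤ velocitySqGap A B t :=
    velocitySqGap_nonneg A B ht.1.le (ht.2.trans h1)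
  have hint := intervalIntegral.integrableOn_deriv_of_nonneg hcont hderiv hnonneg
  have hftc := intervalIntegral.integral_eq_sub_of_hasDerivAt_of_le h0 hcont hderiv
    ((intervalIntegrable_iff_integrableOn_Ioc_of_le h0).2 hint)
  rw [zero_div, expLogEvidence_zero, expLogEvidence_zero, sub_self, sub_zero,
    intervalIntegral.integral_of_le h0, integral_Ioc_eq_integral_Ioo] at hftc
  rw [klDiv_probPath hA hB h1.ne, ← hftc,
    ofReal_integral_eq_lintegral_ofReal (hint.mono_set Set.Ioo_subset_Ioc_self)
      ((ae_restrict_mem measurableSet_Ioo).mono hnonneg)]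

theorem measurable_velocitySqGap (A B : Measure (EuclideanSpace ℝ (Fin d))) [SFinite A]
    [SFinite B] : Measurable (velocitySqGap A B) := by
  have hsq : Measurable fun q : ℝ × EuclideanSpace ℝ (Fin d) × EuclideanSpace ℝ (Fin d) =>
      ‖velocity A q.1 (linearFlow q.1 q.2.1 q.2.2) -
        velocity B q.1 (linearFlow q.1 q.2.1 q.2.2)‖ ^ 2 := by fun_prop
  have hint := hsq.stronglyMeasurable.integral_prod_right'
    (ν := A.prod (stdGaussian (EuclideanSpace ℝ (Fin d))))
  have hgap (t : ℝ) := integral_probPath A t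
    (f := fun x => ‖velocity A t x - velocity B t x‖ ^ 2) (by fun_prop)
  unfold velocitySqGap
  simp only [hgap]
  exact (by fun_prop : Measurable fun t : ℝ => t / (1 - t)).mul hint.measurable

theorem klDiv_eq_lintegral_velocitySqGap (hA : MemLp id 2 A) (hB : MemLp id 2 B) :
    klDiv A B = ∫⁻ t in Set.Ioo 0 1, ENNReal.ofReal (velocitySqGap A B t) := by
  have hcover : AECover (volume.restrict (Set.Ioo (0 : ℝ) 1)) (𝓝[<] 1) fun b => Set.Ioo 0 b :=
    aecover_Ioo_of_Ioo tendsto_const_nhds nhdsWithin_le_nhds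
  have hpath : Tendsto (fun b => klDiv (probPath A b) (probPath B b)) (𝓝[<] 1)
      (𝓝 (klDiv A B)) := tendsto_klDiv_probPath.mono_left nhdsWithin_le_nhds
  refine tendsto_nhds_unique_of_eventuallyEq hpath
    (hcover.lintegral_tendsto_of_countably_generated
      (measurable_velocitySqGap A B).ennreal_ofReal.aemeasurable) ?_
  filter_upwards [Ioo_mem_nhdsLT zero_lt_one] with b hb
  rw [klDiv_probPath_eq_lintegral_velocitySqGap hA hB hb.1.le hb.2,
    Measure.restrict_restrict measurableSet_Ioo,
    Set.inter_eq_left.2 (Set.Ioo_subset_Ioo_right hb.2.le)]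

end Derivative

section CrossTerm

variable {t : ℝ}

theorem condVelocity_linearFlow (ht : t ≠ 1) (x₁ x : EuclideanSpace ℝ (Fin d)) :
    condVelocity t x₁ (linearFlow t x₁ x) = x₁ - x := by
  have hsub : x₁ - linearFlow t x₁ x = (1 - t) • (x₁ - x) := by
    unfold linearFlow
    module
  rw [condVelocity, hsub, inv_smul_smul₀ (sub_ne_zero.2 ht.symm)]

/-- The difference between the integrands of `velocityGap A B t` and `velocitySqGap A B t`, at the
point `X_t = ψ_t(X₀ ∣ X₁)` with `p = (X₁, X₀)`, except that the conditional velocity replaces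
`u_t^A`: this makes it independent of `A`, so that it can be averaged over target laws. -/
def crossTerm (B : Measure (EuclideanSpace ℝ (Fin d))) (t : ℝ)
    (p : EuclideanSpace ℝ (Fin d) × EuclideanSpace ℝ (Fin d)) : ℝ :=
  t / (1 - t) * ⟪condVelocity t p.1 (linearFlow t p.1 p.2) - velocity B t (linearFlow t p.1 p.2),
    velocity B t (linearFlow t p.1 p.2)⟫

theorem measurable_crossTerm (B : Measure (EuclideanSpace ℝ (Fin d))) [SFinite B] :
    Measurable fun q : ℝ × EuclideanSpace ℝ (Fin d) × EuclideanSpace ℝ (Fin d) =>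
      crossTerm B q.1 q.2 := by
  unfold crossTerm
  fun_prop

theorem memLp_comp_linearFlow {φ : EuclideanSpace ℝ (Fin d) → EuclideanSpace ℝ (Fin d)}
    (hφ : MemLp φ 2 (probPath A t)) :
    MemLp (fun p => φ (linearFlow t p.1 p.2)) 2
      (A.prod (stdGaussian (EuclideanSpace ℝ (Fin d)))) :=
  hφ.comp_of_map (Measurable.aemeasurable (by fun_prop))

variable [IsProbabilityMeasure A] [IsProbabilityMeasure B]

theorem memLp_condVelocity_linearFlow (hA : MemLp id 2 A) (ht : t ≠ 1) :
    MemLp (fun p => condVelocity t p.1 (linearFlow t p.1 p.2)) 2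
      (A.prod (stdGaussian (EuclideanSpace ℝ (Fin d)))) := by
  simp only [condVelocity_linearFlow ht]
  exact (hA.comp_fst _).sub (IsGaussian.memLp_two_id.comp_snd A)

theorem memLp_velocity (hA : MemLp id 2 A) (hB : MemLp id 2 B) (h0 : t ≠ 0) (h1 : t ≠ 1) :
    MemLp (velocity B t) 2 (probPath A t) := by
  have hs : 1 - t ≠ 0 := sub_ne_zero.2 h1.symm
  refine (memLp_map_measure_iff (Measurable.aestronglyMeasurable (by fun_prop))
    (Measurable.aemeasurable (by fun_prop))).2 ?_
  simp only [Function.comp_def, velocity_eq hB h1, linearFlow_eq_smul h1, inv_smul_smul₀ hs]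
  exact ((memLp_posteriorMean_path hA hB (div_ne_zero h0 hs)).sub
    ((memLp_path hA _).const_smul (1 - t))).const_smul (1 - t)⁻¹

theorem integral_inner_condVelocity (hA : MemLp id 2 A) (h0 : t ≠ 0) (h1 : t ≠ 1)
    {φ : EuclideanSpace ℝ (Fin d) → EuclideanSpace ℝ (Fin d)} (hφ : Measurable φ)
    (hφ2 : MemLp φ 2 (probPath A t)) :
    ∫ p, ⟪condVelocity t p.1 (linearFlow t p.1 p.2), φ (linearFlow t p.1 p.2)⟫
        ∂(A.prod (stdGaussian (EuclideanSpace ℝ (Fin d)))) =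
      ∫ x, ⟪velocity A t x, φ x⟫ ∂(probPath A t) := by
  have hs : 1 - t ≠ 0 := sub_ne_zero.2 h1.symm
  have ha : t / (1 - t) ≠ 0 := div_ne_zero h0 hs
  have hφ2' := memLp_comp_linearFlow hφ2
  simp only [linearFlow_eq_smul h1] at hφ2'
  have hfst := integrable_inner_of_memLp_two (hA.comp_fst _) hφ2'
  have hmean := integrable_inner_of_memLp_two (memLp_posteriorMean_path hA hA ha) hφ2'
  have hpath := (integrable_inner_of_memLp_two (memLp_path hA (t / (1 - t))) hφ2').const_mul (1 - t)
  have htower := integral_inner_fst_eq_integral_inner_posteriorMean hA ha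
    (φ := fun z => φ ((1 - t) • z)) (by fun_prop) hφ2'
  rw [integral_probPath A t (f := fun x => ⟪velocity A t x, φ x⟫) (by fun_prop)]
  simp only [condVelocity, velocity_eq hA h1, linearFlow_eq_smul h1, inv_smul_smul₀ hs,
    real_inner_smul_left, inner_sub_left, integral_const_mul]
  simp only [id] at hfst
  rw [integral_sub hfst hpath, integral_sub hmean hpath, htower]

theorem integrable_crossTerm (hA : MemLp id 2 A) (hB : MemLp id 2 B) (h0 : t ≠ 0) (h1 : t ≠ 1) :
    Integrable (crossTerm B t) (A.prod (stdGaussian (EuclideanSpace ℝ (Fin d)))) :=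
  have hvel := memLp_comp_linearFlow (memLp_velocity hA hB h0 h1)
  (integrable_inner_of_memLp_two ((memLp_condVelocity_linearFlow hA h1).sub hvel) hvel).const_mul _

theorem integral_crossTerm (hA : MemLp id 2 A) (hB : MemLp id 2 B) (h0 : t ≠ 0) (h1 : t ≠ 1) :
    ∫ p, crossTerm B t p ∂(A.prod (stdGaussian (EuclideanSpace ℝ (Fin d)))) =
      t / (1 - t) * ∫ x, ⟪velocity A t x - velocity B t x, velocity B t x⟫ ∂(probPath A t) := by
  have hvelA := memLp_velocity hA hA h0 h1
  have hvelB := memLp_velocity hA hB h0 h1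
  have hvelB' := memLp_comp_linearFlow hvelB
  simp only [crossTerm, integral_const_mul, inner_sub_left]
  rw [integral_sub (integrable_inner_of_memLp_two (memLp_condVelocity_linearFlow hA h1) hvelB')
      (integrable_inner_of_memLp_two hvelB' hvelB'),
    integral_sub (integrable_inner_of_memLp_two hvelA hvelB)
      (integrable_inner_of_memLp_two hvelB hvelB),
    integral_inner_condVelocity hA h0 h1 (by fun_prop) hvelB,
    integral_probPath A t (f := fun x => ⟪velocity B t x, velocity B t x⟫) (by fun_prop)]

theorem velocityGap_eq_velocitySqGap_add (hA : MemLp id 2 A) (hB : MemLp id 2 B) (h0 : t ≠ 0)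
    (h1 : t ≠ 1) :
    velocityGap A B t = velocitySqGap A B t +
      ∫ p, crossTerm B t p ∂(A.prod (stdGaussian (EuclideanSpace ℝ (Fin d)))) := by
  have hvelB := memLp_velocity hA hB h0 h1
  have hsub : MemLp (fun x => velocity A t x - velocity B t x) 2 (probPath A t) :=
    (memLp_velocity hA hA h0 h1).sub hvelB
  rw [velocityGap, velocitySqGap, integral_crossTerm hA hB h0 h1, integral_const_mul, ← mul_add,
    ← integral_add (integrable_norm_sq_comp_of_memLp_two hsub)
      (integrable_inner_of_memLp_two hsub hvelB)]
  congr 2 with x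
  rw [← real_inner_self_eq_norm_sq, ← inner_add_right, sub_add_cancel, real_inner_comm]

end CrossTerm

end Flow

section Mixture

variable {T S S' E : Type*} [MeasurableSpace T] [MeasurableSpace S] [MeasurableSpace S']
  [NormedAddCommGroup E] {μ : Measure T} {κ : Kernel T S}

theorem ae_memLp_of_memLp_comp {f : S → E} {p : ℝ≥0∞} (h0 : p ≠ 0) (htop : p ≠ ⊤)
    (hf : MemLp f p (κ ∘ₘ μ)) : ∀ᵐ y ∂μ, MemLp f p (κ y) := by
  have hmeas : ∀ᵐ y ∂μ, AEStronglyMeasurable f (κ y) := by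
    have h := hf.1
    rw [Measure.comp_eq_comp_const_apply] at h
    exact h.comp
  filter_upwards [hmeas, Measure.ae_integrable_of_integrable_comp
    (hf.integrable_norm_rpow h0 htop)] with y hy hint
  exact (integrable_norm_rpow_iff hy h0 htop).1 hint

theorem prod_const_comp_eq_prod [SFinite μ] [IsSFiniteKernel κ] (ν : Measure S') [SFinite ν] :
    (κ ×ₖ Kernel.const T ν) ∘ₘ μ = (κ ∘ₘ μ).prod ν := by
  simp only [Measure.comp_eq_comp_const_apply, Kernel.prod_const_comp, Kernel.prod_apply,
    Kernel.const_apply]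

variable [NormedSpace ℝ E] {f : S → E}

theorem integrable_integral_of_integrable_comp (hf : Integrable f (κ ∘ₘ μ)) :
    Integrable (fun y => ∫ x, f x ∂(κ y)) μ := by
  rw [Measure.comp_eq_comp_const_apply] at hf
  exact hf.integral_comp

theorem integral_comp_eq_integral_integral (hf : Integrable f (κ ∘ₘ μ)) :
    ∫ x, f x ∂(κ ∘ₘ μ) = ∫ y, ∫ x, f x ∂(κ y) ∂μ := by
  rw [Measure.comp_eq_comp_const_apply] at hf ⊢
  rw [Kernel.integral_comp hf, Kernel.const_apply]

end Mixture

section Averaging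

variable {𝒴 : Type*} [MeasurableSpace 𝒴] {d : ℕ} {μ : Measure 𝒴} [IsProbabilityMeasure μ]
  {κ : Kernel 𝒴 (EuclideanSpace ℝ (Fin d))} [IsMarkovKernel κ]

variable (κ) in
theorem stronglyMeasurable_integral_crossTerm (B : Measure (EuclideanSpace ℝ (Fin d)))
    [SFinite B] :
    StronglyMeasurable fun z : 𝒴 × ℝ => ∫ p, crossTerm B z.2 p
      ∂((κ z.1).prod (stdGaussian (EuclideanSpace ℝ (Fin d)))) := by
  have hm : StronglyMeasurable fun q : (𝒴 × ℝ) × EuclideanSpace ℝ (Fin d) ×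
      EuclideanSpace ℝ (Fin d) => crossTerm B q.1.2 q.2 :=
    ((measurable_crossTerm B).comp
      ((measurable_snd.comp measurable_fst).prodMk measurable_snd)).stronglyMeasurable
  simpa only [Kernel.prod_apply, Kernel.comap_apply, Kernel.const_apply] using
    hm.integral_kernel_prod_right' (κ := (κ.comap Prod.fst measurable_fst) ×ₖ
      (Kernel.const (𝒴 × ℝ) (stdGaussian (EuclideanSpace ℝ (Fin d)))))

theorem integrable_integral_crossTerm (hκ : MemLp id 2 (κ ∘ₘ μ)) {t : ℝ} (h0 : t ≠ 0)
    (h1 : t ≠ 1) :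
    Integrable (fun y => ∫ p, crossTerm (κ ∘ₘ μ) t p
      ∂((κ y).prod (stdGaussian (EuclideanSpace ℝ (Fin d))))) μ := by
  have h := integrable_crossTerm hκ hκ h0 h1
  rw [← prod_const_comp_eq_prod] at h
  simpa only [Kernel.prod_apply, Kernel.const_apply] using integrable_integral_of_integrable_comp h

theorem integral_integral_crossTerm (hκ : MemLp id 2 (κ ∘ₘ μ)) {t : ℝ} (h0 : t ≠ 0)
    (h1 : t ≠ 1) :
    ∫ y, ∫ p, crossTerm (κ ∘ₘ μ) t p
      ∂((κ y).prod (stdGaussian (EuclideanSpace ℝ (Fin d)))) ∂μ = 0 := by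
  have hint := integrable_crossTerm hκ hκ h0 h1
  have hzero := integral_crossTerm hκ hκ h0 h1
  rw [← prod_const_comp_eq_prod] at hint hzero
  rw [integral_comp_eq_integral_integral hint] at hzero
  simpa only [Kernel.prod_apply, Kernel.const_apply, sub_self, inner_zero_left, integral_zero,
    mul_zero] using hzero

theorem ae_velocityGap_eq_velocitySqGap_add (hκ : MemLp id 2 (κ ∘ₘ μ)) :
    ∀ᵐ y ∂μ, ∀ t ∈ Set.Ioo (0 : ℝ) 1, velocityGap (κ y) (κ ∘ₘ μ) t =
      velocitySqGap (κ y) (κ ∘ₘ μ) t + ∫ p, crossTerm (κ ∘ₘ μ) t p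
        ∂((κ y).prod (stdGaussian (EuclideanSpace ℝ (Fin d)))) := by
  filter_upwards [ae_memLp_of_memLp_comp two_ne_zero ENNReal.ofNat_ne_top hκ] with y hy t ht
  exact velocityGap_eq_velocitySqGap_add hy hκ ht.1.ne' ht.2.ne

theorem aemeasurable_velocitySqGap (hκ : MemLp id 2 (κ ∘ₘ μ))
    (hgap : AEMeasurable (fun z : 𝒴 × ℝ => velocityGap (κ z.1) (κ ∘ₘ μ) z.2)
      (μ.prod (volume.restrict (Set.Ioo (0 : ℝ) 1)))) :
    AEMeasurable (fun z : 𝒴 × ℝ => velocitySqGap (κ z.1) (κ ∘ₘ μ) z.2)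
      (μ.prod (volume.restrict (Set.Ioo (0 : ℝ) 1))) := by
  refine (hgap.sub
    (stronglyMeasurable_integral_crossTerm κ (κ ∘ₘ μ)).measurable.aemeasurable).congr ?_
  filter_upwards [Measure.quasiMeasurePreserving_fst.ae (ae_velocityGap_eq_velocitySqGap_add hκ),
    Measure.quasiMeasurePreserving_snd.ae (ae_restrict_mem measurableSet_Ioo)] with z hz hz'
  simp only [Pi.sub_apply, hz z.2 hz', add_sub_cancel_right]

theorem ae_klDiv_eq_lintegral_velocitySqGap (hκ : MemLp id 2 (κ ∘ₘ μ)) :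
    ∀ᵐ y ∂μ, klDiv (κ y) (κ ∘ₘ μ) =
      ∫⁻ t in Set.Ioo (0 : ℝ) 1, ENNReal.ofReal (velocitySqGap (κ y) (κ ∘ₘ μ) t) :=
  (ae_memLp_of_memLp_comp two_ne_zero ENNReal.ofNat_ne_top hκ).mono
    fun _ hy => klDiv_eq_lintegral_velocitySqGap hy hκ

section FixedTime

variable {t : ℝ}

theorem integrable_velocitySqGap (hκ : MemLp id 2 (κ ∘ₘ μ)) (ht : t ∈ Set.Ioo (0 : ℝ) 1)
    (hgap : Integrable (fun y => velocityGap (κ y) (κ ∘ₘ μ) t) μ) :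
    Integrable (fun y => velocitySqGap (κ y) (κ ∘ₘ μ) t) μ := by
  refine (hgap.sub (integrable_integral_crossTerm hκ ht.1.ne' ht.2.ne)).congr ?_
  filter_upwards [ae_velocityGap_eq_velocitySqGap_add hκ] with y hy
  simp only [Pi.sub_apply, hy t ht, add_sub_cancel_right]

theorem integral_velocityGap_eq_integral_velocitySqGap (hκ : MemLp id 2 (κ ∘ₘ μ))
    (ht : t ∈ Set.Ioo (0 : ℝ) 1)
    (hgap : Integrable (fun y => velocityGap (κ y) (κ ∘ₘ μ) t) μ) :
    ∫ y, velocityGap (κ y) (κ ∘ₘ μ) t ∂μ = ∫ y, velocitySqGap (κ y) (κ ∘ₘ μ) t ∂μ := by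
  rw [integral_congr_ae ((ae_velocityGap_eq_velocitySqGap_add hκ).mono fun y hy => hy t ht),
    integral_add (integrable_velocitySqGap hκ ht hgap)
      (integrable_integral_crossTerm hκ ht.1.ne' ht.2.ne),
    integral_integral_crossTerm hκ ht.1.ne' ht.2.ne, add_zero]

theorem integral_velocityGap_nonneg (hκ : MemLp id 2 (κ ∘ₘ μ)) (ht : t ∈ Set.Ioo (0 : ℝ) 1)
    (hgap : Integrable (fun y => velocityGap (κ y) (κ ∘ₘ μ) t) μ) :
    0 ≤ ∫ y, velocityGap (κ y) (κ ∘ₘ μ) t ∂μ := by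
  rw [integral_velocityGap_eq_integral_velocitySqGap hκ ht hgap]
  exact integral_nonneg fun y => velocitySqGap_nonneg _ _ ht.1.le ht.2

theorem lintegral_velocitySqGap (hκ : MemLp id 2 (κ ∘ₘ μ)) (ht : t ∈ Set.Ioo (0 : ℝ) 1)
    (hgap : Integrable (fun y => velocityGap (κ y) (κ ∘ₘ μ) t) μ) :
    ∫⁻ y, ENNReal.ofReal (velocitySqGap (κ y) (κ ∘ₘ μ) t) ∂μ =
      ENNReal.ofReal (∫ y, velocityGap (κ y) (κ ∘ₘ μ) t ∂μ) := by
  rw [integral_velocityGap_eq_integral_velocitySqGap hκ ht hgap,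
    ofReal_integral_eq_lintegral_ofReal (integrable_velocitySqGap hκ ht hgap)
      (ae_of_all _ fun y => velocitySqGap_nonneg _ _ ht.1.le ht.2)]

end FixedTime

theorem ae_integral_velocityGap_nonneg (hκ : MemLp id 2 (κ ∘ₘ μ))
    (hint : Integrable (fun z : 𝒴 × ℝ => velocityGap (κ z.1) (κ ∘ₘ μ) z.2)
      (μ.prod (volume.restrict (Set.Ioo (0 : ℝ) 1)))) :
    ∀ᵐ t ∂(volume.restrict (Set.Ioo (0 : ℝ) 1)), 0 ≤ ∫ y, velocityGap (κ y) (κ ∘ₘ μ) t ∂μ := by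
  filter_upwards [hint.prod_left_ae, ae_restrict_mem measurableSet_Ioo] with t hgap ht
  exact integral_velocityGap_nonneg hκ ht hgap

theorem integral_integral_velocityGap_nonneg (hκ : MemLp id 2 (κ ∘ₘ μ))
    (hint : Integrable (fun z : 𝒴 × ℝ => velocityGap (κ z.1) (κ ∘ₘ μ) z.2)
      (μ.prod (volume.restrict (Set.Ioo (0 : ℝ) 1)))) :
    0 ≤ ∫ y, (∫ t in Set.Ioo (0 : ℝ) 1, velocityGap (κ y) (κ ∘ₘ μ) t) ∂μ := by
  rw [integral_integral_swap hint]
  exact integral_nonneg_of_ae (ae_integral_velocityGap_nonneg hκ hint)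

theorem lintegral_klDiv_comp_eq_ofReal_integral_velocityGap (hκ : MemLp id 2 (κ ∘ₘ μ))
    (hint : Integrable (fun z : 𝒴 × ℝ => velocityGap (κ z.1) (κ ∘ₘ μ) z.2)
      (μ.prod (volume.restrict (Set.Ioo (0 : ℝ) 1)))) :
    ∫⁻ y, klDiv (κ y) (κ ∘ₘ μ) ∂μ =
      ENNReal.ofReal (∫ y, (∫ t in Set.Ioo (0 : ℝ) 1, velocityGap (κ y) (κ ∘ₘ μ) t) ∂μ) := by
  calc ∫⁻ y, klDiv (κ y) (κ ∘ₘ μ) ∂μ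
      = ∫⁻ y, (∫⁻ t in Set.Ioo (0 : ℝ) 1,
          ENNReal.ofReal (velocitySqGap (κ y) (κ ∘ₘ μ) t)) ∂μ :=
        lintegral_congr_ae (ae_klDiv_eq_lintegral_velocitySqGap hκ)
    _ = ∫⁻ t in Set.Ioo (0 : ℝ) 1, ∫⁻ y,
          ENNReal.ofReal (velocitySqGap (κ y) (κ ∘ₘ μ) t) ∂μ :=
        lintegral_lintegral_swap (aemeasurable_velocitySqGap hκ hint.1.aemeasurable).ennreal_ofReal
    _ = ∫⁻ t in Set.Ioo (0 : ℝ) 1, ENNReal.ofReal (∫ y, velocityGap (κ y) (κ ∘ₘ μ) t ∂μ) := by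
        refine lintegral_congr_ae ?_
        filter_upwards [hint.prod_left_ae, ae_restrict_mem measurableSet_Ioo] with t hgap ht
        exact lintegral_velocitySqGap hκ ht hgap
    _ = ENNReal.ofReal (∫ t in Set.Ioo (0 : ℝ) 1, ∫ y, velocityGap (κ y) (κ ∘ₘ μ) t ∂μ) :=
        (ofReal_integral_eq_lintegral_ofReal hint.integral_prod_right
          (ae_integral_velocityGap_nonneg hκ hint)).symm
    _ = ENNReal.ofReal (∫ y, (∫ t in Set.Ioo (0 : ℝ) 1, velocityGap (κ y) (κ ∘ₘ μ) t) ∂μ) := by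
        rw [integral_integral_swap (f := fun y t => velocityGap (κ y) (κ ∘ₘ μ) t) hint]

end Averaging

section MutualInformation

theorem mutualInfo_eq_lintegral_klDiv_condDistrib {Ω T S : Type*} [MeasurableSpace Ω]
    [MeasurableSpace T] [MeasurableSpace S] [StandardBorelSpace S] [Nonempty S] (P : Measure Ω)
    [IsFiniteMeasure P] {X : Ω → S} {Y : Ω → T} (hX : Measurable X) (hY : Measurable Y) :
    mutualInfo P X Y = ∫⁻ y, klDiv (condDistrib X Y P y) (P.map X) ∂(P.map Y) := by
  have hjoint : P.map (fun ω => (X ω, Y ω)) =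
      (P.map Y ⊗ₘ condDistrib X Y P).map MeasurableEquiv.prodComm := by
    rw [compProd_map_condDistrib hX.aemeasurable,
      Measure.map_map MeasurableEquiv.prodComm.measurable (hY.prodMk hX)]
    rfl
  have hprod : (P.map X).prod (P.map Y) =
      (P.map Y ⊗ₘ Kernel.const T (P.map X)).map MeasurableEquiv.prodComm := by
    rw [Measure.compProd_const]
    exact Measure.prod_swap.symm
  rw [mutualInfo, hjoint, hprod, klDiv_map_measurableEquiv, klDiv_compProd_right]
  simp only [Kernel.const_apply]

theorem integral_density_mul_log_eq_toReal_klDiv {d : ℕ}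
    {A B : Measure (EuclideanSpace ℝ (Fin d))} [IsProbabilityMeasure A] [IsProbabilityMeasure B]
    (hB : B ≪ volume) (hAB : A ≪ B) :
    ∫ x, density A x * Real.log (density A x / density B x) = (klDiv A B).toReal := by
  have hA := hAB.trans hB
  rw [toReal_klDiv_of_measure_eq hAB (by simp only [measure_univ])]
  simp only [density]
  rw [integral_toReal_rnDeriv_mul hA]
  refine integral_congr_ae ?_
  filter_upwards [hA.ae_le (Measure.rnDeriv_mul_rnDeriv (κ := volume) hAB),
    hAB.ae_le (Measure.rnDeriv_pos hB), hA.ae_le (B.rnDeriv_ne_top volume)] with x hx hpos hne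
  rw [llr, ← hx, Pi.mul_apply, ENNReal.toReal_mul, mul_div_cancel_right₀]
  exact (ENNReal.toReal_pos hpos.ne' hne).ne'

end MutualInformation

end

end FlowMI

theorem mainTheorem1 {Ω : Type*} [MeasurableSpace Ω] (P : Measure Ω) [IsProbabilityMeasure P]
    {𝒴 : Type*} [MeasurableSpace 𝒴] {d : ℕ}
    (X : Ω → EuclideanSpace ℝ (Fin d)) (Y : Ω → 𝒴)
    (hX : Measurable X) (hY : Measurable Y)
    (hXpdf : ∀ᵐ y ∂(P.map Y), condDistrib X Y P y ≪ volume)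
    (hX2 : MemLp X 2 P)
    (hint : Integrable
      (fun z : 𝒴 × ℝ => FlowMI.velocityGap (condDistrib X Y P z.1) (P.map X) z.2)
      ((P.map Y).prod (volume.restrict (Set.Ioo (0 : ℝ) 1)))) :
    FlowMI.mutualInfo P X Y ≠ ⊤ ∧
    FlowMI.mutualInfo P X Y = ∫⁻ y, klDiv (condDistrib X Y P y) (P.map X) ∂(P.map Y) ∧
    (FlowMI.mutualInfo P X Y).toReal =
      ∫ y, (∫ x, FlowMI.density (condDistrib X Y P y) x *
        Real.log (FlowMI.density (condDistrib X Y P y) x / FlowMI.density (P.map X) x))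
        ∂(P.map Y) ∧
    (FlowMI.mutualInfo P X Y).toReal =
      ∫ y, (∫ t in (0 : ℝ)..1, FlowMI.velocityGap (condDistrib X Y P y) (P.map X) t)
        ∂(P.map Y) := by
  have : IsProbabilityMeasure (P.map Y) := Measure.isProbabilityMeasure_map hY.aemeasurable
  have : IsProbabilityMeasure (P.map X) := Measure.isProbabilityMeasure_map hX.aemeasurable
  have hmix := condDistrib_comp_map (μ := P) hY.aemeasurable hX.aemeasurable
  have hmom : MemLp id 2 (P.map X) :=
    (memLp_map_measure_iff aestronglyMeasurable_id hX.aemeasurable).2 hX2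
  have hMI := FlowMI.mutualInfo_eq_lintegral_klDiv_condDistrib P hX hY
  have hgap := FlowMI.lintegral_klDiv_comp_eq_ofReal_integral_velocityGap
    (hmix.symm ▸ hmom) (hmix.symm ▸ hint)
  have hnonneg := FlowMI.integral_integral_velocityGap_nonneg
    (hmix.symm ▸ hmom) (hmix.symm ▸ hint)
  rw [hmix] at hgap hnonneg
  rw [← hMI] at hgap
  have hfin : FlowMI.mutualInfo P X Y ≠ ⊤ := hgap ▸ ENNReal.ofReal_ne_top
  have hmeas : Measurable fun y => klDiv (condDistrib X Y P y) (P.map X) :=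
    FlowMI.measurable_klDiv_kernel (η := Kernel.const 𝒴 (P.map X))
  have hlt := ae_lt_top hmeas (hMI ▸ hfin)
  have hvol : P.map X ≪ volume := by
    simpa only [hmix, Measure.const_comp, measure_univ, one_smul] using
      Measure.AbsolutelyContinuous.comp_left (η := Kernel.const 𝒴 volume) (P.map Y) hXpdf
  refine ⟨hfin, hMI, ?_, ?_⟩
  · rw [hMI, ← integral_toReal hmeas.aemeasurable hlt]
    refine integral_congr_ae (hlt.mono fun y hy => ?_)
    exact (FlowMI.integral_density_mul_log_eq_toReal_klDiv hvol (klDiv_ne_top_iff.1 hy.ne).1).symm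
  · simp only [intervalIntegral.integral_of_le zero_le_one, integral_Ioc_eq_integral_Ioo]
    rw [hgap, ENNReal.toReal_ofReal hnonneg]
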